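/- Let $L=\{L(s,t);\ s,t\ge 0\}$ be a real-valued Lévy sheet with exponent $\Psi=a+ib:\mathbb R\to\mathbb C$ ($a,b$ real-valued) on a probability space. That is, $L(s,0)=L(0,t)=0$ almost surely for all $s,t\ge 0$; $L$ is continuous in probability; the increments $\Delta_{Q}L:=L(s',t')-L(s,t')-L(s',t)+L(s,t)$ over pairwise disjoint rectangles $Q=(s,s']\times(t,t']\subset\mathbb R_+^2$ are independent; and $\mathbb E[e^{i\xi\Delta_Q L}]=e^{-\lambda(Q)\Psi(\xi)}$ for all such rectangles $Q$ and all $\xi\in\mathbb R$, where $\lambda$ is the Lebesgue measure. Assume that $L$ is jointly measurable in $(s,t,\omega)$. Let $\theta\in(0,2\pi)$ with $a(\theta)a(2\theta)\neq 0$, put $$K=\frac1{\sqrt2}\,\frac{a(\theta)^2+b(\theta)^2}{a(\theta)},$$ and for $n\in\mathbb N$, $n\ge 1$, and $s,y\in[0,1]$ define $$\theta_n^1(s,y)=nK\sqrt{sy}\,\cos\big(\theta L(\sqrt n\,s,\sqrt n\,y)\big),\qquad \theta_n^2(s,y)=nK\sqrt{sy}\,\sin\big(\theta L(\sqrt n\,s,\sqrt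 n\,y)\big).$$ Then for every even $m\in\mathbb N$ there is a constant $C_m>0$ such that, for every real-valued $f\in L^2([0,1]^2)$, all $s_0,s_0',x_0,x_0'\in[0,1]$ with $0<s_0<s_0'<2s_0$ and $0<x_0<x_0'<2x_0$, and each $i\in\{1,2\}$, the random variables below are integrable and $$\sup_{n\ge1}\,\mathbb E\left[\left(\int_{s_0}^{s_0'}\int_{x_0}^{x_0'} f(s,y)\,\theta_n^i(s,y)\,dy\,ds\right)^{m}\right]\le C_m\left(\int_{s_0}^{s_0'}\int_{x_0}^{x_0'} f(s,y)^2\,dy\,ds\right)^{m/2}.$$ -/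

import Mathlib

open MeasureTheory ProbabilityTheory Topology
open scoped NNReal

namespace LevySheet

/-- The increment `Δ_{s,t} Y (s',t')` of a random field `Y` indexed by the quadrant `ℝ₊²` on the
rectangle `(s, s'] × (t, t']`. -/
def increment {Ω : Type*} (Y : ℝ≥0 → ℝ≥0 → Ω → ℝ) (s t s' t' : ℝ≥0) (ω : Ω) : ℝ :=
  Y s' t' ω - Y s t' ω - Y s' t ω + Y s t ω

/-- `L` is a Lévy sheet with exponent `Ψ` under the probability measure `P`: a real random field
on `ℝ₊²` that vanishes almost surely on the axes, is continuous in probability, has independent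
increments on disjoint rectangles, and satisfies `E[exp(i ξ Δ_Q L)] = exp(-λ(Q) Ψ(ξ))` for every
rectangle `Q`, with `λ` the Lebesgue measure. -/
structure IsLevySheet {Ω : Type*} [MeasurableSpace Ω] (P : Measure Ω)
    (L : ℝ≥0 → ℝ≥0 → Ω → ℝ) (Ψ : ℝ → ℂ) : Prop where
  measurable : ∀ s t, Measurable (L s t)
  zero_left : ∀ t, ∀ᵐ ω ∂P, L 0 t ω = 0
  zero_right : ∀ s, ∀ᵐ ω ∂P, L s 0 ω = 0
  continuous_in_probability : ∀ s t,
    TendstoInMeasure P (fun z : ℝ≥0 × ℝ≥0 => L z.1 z.2) (𝓝 (s, t)) (L s t)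
  indep_increments : ∀ (N : ℕ) (s t s' t' : Fin N → ℝ≥0),
    (∀ k, s k < s' k) → (∀ k, t k < t' k) →
    (Pairwise fun j k => Disjoint (Set.Ioc (s j) (s' j) ×ˢ Set.Ioc (t j) (t' j))
      (Set.Ioc (s k) (s' k) ×ˢ Set.Ioc (t k) (t' k))) →
    iIndepFun (fun k => increment L (s k) (t k) (s' k) (t' k)) P
  charFun_increment : ∀ (s t s' t' : ℝ≥0), s < s' → t < t' → ∀ ξ : ℝ,
    ∫ ω, Complex.exp (Complex.I * (ξ : ℂ) * (increment L s t s' t' ω : ℂ)) ∂P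
      = Complex.exp (-(((((s' : ℝ) - s) * ((t' : ℝ) - t) : ℝ) : ℂ) * Ψ ξ))

/-- The constant `K = (1/√2) (a(θ)² + b(θ)²) / a(θ)`, where `Ψ = a + i b`. -/
noncomputable def constK (Ψ : ℝ → ℂ) (θ : ℝ) : ℝ :=
  (1 / √2) * (((Ψ θ).re ^ 2 + (Ψ θ).im ^ 2) / (Ψ θ).re)

/-- `θ_n¹(s,y) = n K √(s y) cos(θ L(√n s, √n y))`, for `s, y ≥ 0`. -/
noncomputable def theta1 {Ω : Type*} (L : ℝ≥0 → ℝ≥0 → Ω → ℝ) (Ψ : ℝ → ℂ) (θ : ℝ) (n : ℕ)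
    (s y : ℝ) (ω : Ω) : ℝ :=
  n * constK Ψ θ * √(s * y) *
    Real.cos (θ * L (Real.toNNReal (√(n : ℝ) * s)) (Real.toNNReal (√(n : ℝ) * y)) ω)

/-- `θ_n²(s,y) = n K √(s y) sin(θ L(√n s, √n y))`, for `s, y ≥ 0`. -/
noncomputable def theta2 {Ω : Type*} (L : ℝ≥0 → ℝ≥0 → Ω → ℝ) (Ψ : ℝ → ℂ) (θ : ℝ) (n : ℕ)
    (s y : ℝ) (ω : Ω) : ℝ :=
  n * constK Ψ θ * √(s * y) *
    Real.sin (θ * L (Real.toNNReal (√(n : ℝ) * s)) (Real.toNNReal (√(n : ℝ) * y)) ω)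

/-- The two families `θ_n^i`; the indices `0, 1 : Fin 2` stand for `i = 1, 2`. -/
noncomputable def thetaField {Ω : Type*} (i : Fin 2) (L : ℝ≥0 → ℝ≥0 → Ω → ℝ) (Ψ : ℝ → ℂ)
    (θ : ℝ) (n : ℕ) (s y : ℝ) (ω : Ω) : ℝ :=
  ![theta1 L Ψ θ n s y ω, theta2 L Ψ θ n s y ω] i

end LevySheet

/-! Both fields are the real and imaginary parts of `n K √(s y) exp(i θ L)`, so it suffices to bound
the moment of order `m = 2k` of the modulus of its integral `U` against `f`. Expanding `(U * conj
U)^k` gives an integral over `2k` points `z_j` of the product of the weights and of `|E exp(i θ ∑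
ε_j L(√n z_j))|`, where half of the signs are `+1` and half are `-1`.

On a grid through these points the signed sum is a combination of independent increments. A cell has
as coefficient the integer `v` obtained by adding the signs of the points above and to the right of
it, and contributes the factor `exp(-area * a(θ v))`. In the strip below all points `v` depends on
the first coordinate only and is a walk from `0` to `0` with steps `±1` (larger when points share a
coordinate). The integers with `a(θ v) = 0` are stable under differences and omit `±1`, so each
single step has a side where `a(θ v)` is positive. The stretch on that side ends at another point,
and its length costs exponential decay (`exists_ne_badCount_eq`, `mul_abs_sub_le_sum`). The same
holds for the second coordinate.

Each point is thus tied to others in two equivalence relations without singleton classes. A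
2-colouring in which no class of either is monochromatic (`exists_coloring_of_setoids`) lets every
point be tied, in each coordinate, to a point of the opposite colour. Cauchy–Schwarz between the
colours then integrates the squared kernels, each giving order `n⁻²`, against the squared weights,
each giving `n² ∫ f²`; the powers of `n` cancel (`lintegral_prod_mul_kernel_sq_le`). -/

namespace LevySheet

/-! ### Colourings for pairs of involutions and of equivalence relations -/

/-- Two involutions without fixed points admit a common alternating `2`-colouring. -/
lemma exists_coloring_of_fixedPointFree {α : Type*} {p q : α → α} (hp : p.Involutive)
    (hq : q.Involutive) (hp0 : ∀ x, p x ≠ x) (hq0 : ∀ x, q x ≠ x) :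
    ∃ χ : α → Bool, (∀ x, χ (p x) ≠ χ x) ∧ ∀ x, χ (q x) ≠ χ x := by
  classical
  let P := hp.toPerm
  let Q := hq.toPerm
  have hPP : P * P = 1 := by ext x; exact hp x
  have hQQ : Q * Q = 1 := by ext x; exact hq x
  have hPi : P⁻¹ = P := inv_eq_of_mul_eq_one_left hPP
  have hQi : Q⁻¹ = Q := inv_eq_of_mul_eq_one_left hQQ
  let r : Equiv.Perm α := Q * P
  -- Conjugation by `p` inverts `r = q ∘ p`, so `p` permutes the orbits of `r`.
  have hconj : P * r * P⁻¹ = r⁻¹ := by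
    simp only [r, mul_inv_rev, hPi, hQi, mul_assoc, hPP, mul_one]
  have hpow : ∀ k : ℤ, ∀ x, p ((r ^ k) x) = (r ^ (-k)) (p x) := by
    intro k x
    have h1 : P * r ^ k = r ^ (-k) * P := by
      have h2 : P * r ^ k * P⁻¹ = r ^ (-k) := by
        rw [← conj_zpow, hconj, inv_zpow', zpow_neg]
      rw [← h2]; simp
    exact congrArg (fun e : Equiv.Perm α => e x) h1
  have hrx : ∀ x, r x = q (p x) := fun _ => rfl
  -- If `p x = r^k x`, the midpoint of the cycle segment yields a fixed point: of `p` when `k` is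
  -- even, of `q` when `k` is odd.
  have hne : ∀ x, ¬ r.SameCycle x (p x) := by
    rintro x ⟨k, hk⟩
    rcases Int.even_or_odd' k with ⟨l, rfl | rfl⟩
    · apply hp0 ((r ^ l) x)
      rw [hpow, ← hk, ← Equiv.Perm.mul_apply, ← zpow_add]
      congr 2; ring
    · have h1 : p ((r ^ l) x) = r ((r ^ l) x) := by
        rw [hpow, ← hk, ← Equiv.Perm.mul_apply, ← zpow_add, ← Equiv.Perm.mul_apply,
          ← zpow_one_add]
        congr 2; ring
      rw [hrx] at h1
      exact hq0 _ h1.symm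
  let S := Equiv.Perm.SameCycle.setoid r
  -- The involutions pair the orbits, both in the same way; an arbitrary linear order decides which
  -- orbit of a pair gets which colour.
  obtain ⟨lo, -⟩ := exists_wellFoundedLT (Quotient S)
  let O : α → Quotient S := fun x => Quotient.mk S x
  have hO : ∀ x y, O x = O y ↔ r.SameCycle x y := fun x y => Quotient.eq
  have hOr : ∀ x, O (r x) = O x := by
    intro x
    rw [hO]
    exact ⟨-1, by simp⟩
  have hOq : ∀ x, O (q x) = O (p x) := by
    intro x
    rw [← hOr (p x), hrx, hp x]
  have hOpq : ∀ x, O (p (q x)) = O x := by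
    intro x
    rw [← hOr (p (q x)), hrx, hp, hq]
  have hlt : ∀ x, O x < O (p x) ↔ ¬ O (p x) < O x := by
    intro x
    have : O x ≠ O (p x) := fun h => hne x ((hO _ _).1 h)
    constructor
    · exact fun h => not_lt.2 h.le
    · exact fun h => lt_of_le_of_ne (not_lt.1 h) this
  refine ⟨fun x => decide (O x < O (p x)), fun x => ?_, fun x => ?_⟩
  · have := hlt x
    simp only [hp x, ne_eq, decide_eq_decide]
    tauto
  · have := hlt x
    simp only [hOq, hOpq, ne_eq, decide_eq_decide]
    tauto

/-- Two involutions admit a common `2`-colouring that alternates on non-fixed points. -/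
lemma exists_coloring_of_involutive {α : Type*} {u v : α → α} (hu : u.Involutive)
    (hv : v.Involutive) :
    ∃ χ : α → Bool, (∀ x, u x ≠ x → χ (u x) ≠ χ x) ∧ ∀ x, v x ≠ x → χ (v x) ≠ χ x := by
  classical
  -- Fixed points are removed by taking two copies of the set and swapping each fixed point with its
  -- twin.
  let d : (α → α) → α × Bool → α × Bool :=
    fun w x => if w x.1 = x.1 then (x.1, !x.2) else (w x.1, x.2)
  have hd : ∀ w : α → α, w.Involutive → (d w).Involutive ∧ ∀ x, d w x ≠ x := by
    intro w hw
    refine ⟨?_, ?_⟩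
    · rintro ⟨x, b⟩
      by_cases h : w x = x
      · simp [d, h]
      · have h' : ¬ x = w x := fun e => h e.symm
        simp [d, h, hw x, h']
    · rintro ⟨x, b⟩
      by_cases h : w x = x <;> simp [d, h]
  obtain ⟨χ, h1, h2⟩ := exists_coloring_of_fixedPointFree (hd u hu).1 (hd v hv).1
    (hd u hu).2 (hd v hv).2
  refine ⟨fun x => χ (x, false), fun x hx => ?_, fun x hx => ?_⟩
  · simpa [d, hx] using h1 (x, false)
  · simpa [d, hx] using h2 (x, false)

/-- One pair of distinct points is chosen in each class; `u` swaps the pair and fixes the rest. -/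
lemma exists_involutive_of_nontrivial {α : Type*} (R : Setoid α) (hR : ∀ x, ∃ y, y ≠ x ∧ R y x) :
    ∃ u : α → α, u.Involutive ∧ ∀ x, ∃ y, R y x ∧ R (u y) x ∧ u y ≠ y := by
  classical
  choose t ht1 ht2 using hR
  let a : α → α := fun x => (Quotient.mk R x).out
  have ha : ∀ x, R (a x) x := fun x => Quotient.mk_out x
  have haeq : ∀ x y, R x y → a x = a y := fun x y h => by
    simp only [a]; rw [Quotient.sound h]
  let b : α → α := fun x => t (a x)
  have hb : ∀ x, R (b x) x := fun x => R.trans (ht2 _) (ha x)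
  have hbeq : ∀ x y, R x y → b x = b y := fun x y h => by simp only [b]; rw [haeq x y h]
  have hba : ∀ x, b x ≠ a x := fun x => ht1 _
  let u : α → α := fun x => if x = a x then b x else if x = b x then a x else x
  have hua : ∀ x, u (a x) = b x := by
    intro x
    simp only [u, haeq _ _ (ha x), hbeq _ _ (ha x), if_true]
  have hub : ∀ x, u (b x) = a x := by
    intro x
    simp only [u, haeq _ _ (hb x), hbeq _ _ (hb x), if_true, if_neg (hba x)]
  refine ⟨u, ?_, ?_⟩
  · intro x
    by_cases h1 : x = a x
    · have : u x = b x := by simp only [u]; rw [if_pos h1]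
      rw [this, hub, ← h1]
    · by_cases h2 : x = b x
      · have : u x = a x := by simp only [u]; rw [if_neg h1, if_pos h2]
        rw [this, hua, ← h2]
      · have : u x = x := by simp only [u]; rw [if_neg h1, if_neg h2]
        rw [this, this]
  · intro x
    refine ⟨a x, ha x, ?_, ?_⟩
    · rw [hua]; exact hb x
    · rw [hua]; exact hba x

/-- Two equivalence relations without singleton classes admit a `2`-colouring for which no class of
either is monochromatic. -/
lemma exists_coloring_of_setoids {α : Type*} (R T : Setoid α) (hR : ∀ x, ∃ y, y ≠ x ∧ R y x)
    (hT : ∀ x, ∃ y, y ≠ x ∧ T y x) :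
    ∃ χ : α → Bool, (∀ x, ∃ y, R y x ∧ χ y ≠ χ x) ∧ ∀ x, ∃ y, T y x ∧ χ y ≠ χ x := by
  obtain ⟨u, hu, hu'⟩ := exists_involutive_of_nontrivial R hR
  obtain ⟨v, hv, hv'⟩ := exists_involutive_of_nontrivial T hT
  obtain ⟨χ, h1, h2⟩ := exists_coloring_of_involutive hu hv
  refine ⟨χ, fun x => ?_, fun x => ?_⟩
  · obtain ⟨y, hy1, hy2, hy3⟩ := hu' x
    -- The chosen pair `y`, `u y` of the class has both colours, so one of them differs from `x`.
    by_cases h : χ y = χ x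
    · exact ⟨u y, hy2, fun e => h1 y hy3 (e.trans h.symm)⟩
    · exact ⟨y, hy1, h⟩
  · obtain ⟨y, hy1, hy2, hy3⟩ := hv' x
    by_cases h : χ y = χ x
    · exact ⟨v y, hy2, fun e => h2 y hy3 (e.trans h.symm)⟩
    · exact ⟨y, hy1, h⟩

/-! ### Integer walks returning to zero -/

/-- The number of `i < n` for which the walk `i ↦ ∑_{j : i < a j} ε j` is at a point of `Z`. -/
noncomputable def badCount {ι : Type*} [Fintype ι] (a : ι → ℕ) (ε : ι → ℤ) (Z : Set ℤ) (n : ℕ) :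
    ℕ := by
  classical
  exact ((Finset.range n).filter fun i => (∑ j, if i < a j then ε j else 0) ∈ Z).card

/-- Equality of counts encodes "no bad value in between" in a form that is visibly an equivalence
relation. -/
lemma notMem_of_badCount_eq {ι : Type*} [Fintype ι] {a : ι → ℕ} {ε : ι → ℤ} {Z : Set ℤ}
    {n n' i : ℕ} (h : badCount a ε Z n = badCount a ε Z n') (h1 : n ≤ i) (h2 : i < n') :
    (∑ j, if i < a j then ε j else 0) ∉ Z := by
  classical
  intro hi
  unfold badCount at h
  have hsub : (Finset.range n).filter (fun i => (∑ j, if i < a j then ε j else 0) ∈ Z) ⊆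
      (Finset.range n').filter (fun i => (∑ j, if i < a j then ε j else 0) ∈ Z) := by
    apply Finset.filter_subset_filter
    intro x hx
    simp only [Finset.mem_range] at *
    omega
  have heq := Finset.eq_of_subset_of_card_le hsub h.ge
  have : i ∈ (Finset.range n).filter (fun i => (∑ j, if i < a j then ε j else 0) ∈ Z) := by
    rw [heq]; simpa using ⟨h2, hi⟩
  simp only [Finset.mem_filter, Finset.mem_range] at this
  omega

lemma badCount_eq_of_notMem {ι : Type*} [Fintype ι] {a : ι → ℕ} {ε : ι → ℤ} {Z : Set ℤ}
    {n n' : ℕ} (hn : n ≤ n')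
    (h : ∀ i, n ≤ i → i < n' → (∑ j, if i < a j then ε j else 0) ∉ Z) :
    badCount a ε Z n = badCount a ε Z n' := by
  classical
  unfold badCount
  congr 1
  ext i
  simp only [Finset.mem_filter, Finset.mem_range]
  constructor
  · rintro ⟨h1, h2⟩; exact ⟨by omega, h2⟩
  · rintro ⟨h1, h2⟩
    refine ⟨?_, h2⟩
    by_contra h3
    exact h i (by omega) h1 h2

/-- Each point of a walk from `0` to `0` whose steps do not join two points of `Z` is
joined to another one by a stretch that avoids `Z`. -/
lemma exists_ne_badCount_eq {ι : Type*} [Fintype ι] (a : ι → ℕ) (ε : ι → ℤ) (Z : Set ℤ)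
    (hε : ∑ j, ε j = 0) (hZ0 : (0 : ℤ) ∈ Z) (hZ : ∀ v j, v ∈ Z → v + ε j ∉ Z)
    (ha : ∀ j, 0 < a j) (j : ι) : ∃ k, k ≠ j ∧ badCount a ε Z (a k) = badCount a ε Z (a j) := by
  classical
  by_cases hex : ∃ k, k ≠ j ∧ a k = a j
  · obtain ⟨k, hk, hk'⟩ := hex
    exact ⟨k, hk, by rw [hk']⟩
  push Not at hex
  -- With no other point at `a j`, the values in the cells before and after it differ by `ε j`, so
  -- at most one lies in `Z`. The cell before exists because `0 < a j`.
  have hstep : (∑ l, if a j - 1 < a l then ε l else 0) =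
      (∑ l, if a j < a l then ε l else 0) + ε j := by
    rw [← Finset.add_sum_erase _ _ (Finset.mem_univ j),
      ← Finset.add_sum_erase (a := j) _ _ (Finset.mem_univ j)]
    have := ha j
    rw [if_pos (by omega), if_neg (by omega), zero_add, add_comm]
    congr 1
    apply Finset.sum_congr rfl
    intro l hl
    have := hex l (Finset.ne_of_mem_erase hl)
    congr 1
    simp only [eq_iff_iff]
    omega
  by_cases hM : (∑ l, if a j < a l then ε l else 0) ∈ Z
  · have hM' : (∑ l, if a j - 1 < a l then ε l else 0) ∉ Z := by
      rw [hstep]; exact hZ _ j hM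
    -- Without an earlier point the value before `a j` would be the total `0`, which lies in `Z`.
    -- The nearest earlier point is the partner.
    have hne : (Finset.univ.filter fun k => a k < a j).Nonempty := by
      by_contra hemp
      rw [Finset.not_nonempty_iff_eq_empty, Finset.filter_eq_empty_iff] at hemp
      apply hM'
      rw [Finset.sum_congr rfl (g := ε), hε]
      · exact hZ0
      · intro l _
        have := hemp (Finset.mem_univ l)
        have := ha j
        rw [if_pos (by omega)]
    obtain ⟨k, hk, hmax⟩ := Finset.exists_max_image _ a hne
    simp only [Finset.mem_filter, Finset.mem_univ, true_and] at hk hmax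
    refine ⟨k, fun e => by rw [e] at hk; omega, badCount_eq_of_notMem hk.le ?_⟩
    intro i h1 h2
    have heq : ∀ l, (if i < a l then ε l else 0) = if a j - 1 < a l then ε l else 0 := by
      intro l
      have := hmax l
      congr 1
      simp only [eq_iff_iff]
      omega
    simpa only [heq] using hM'
  · have hne : (Finset.univ.filter fun k => a j < a k).Nonempty := by
      by_contra hemp
      rw [Finset.not_nonempty_iff_eq_empty, Finset.filter_eq_empty_iff] at hemp
      apply hM
      rw [Finset.sum_eq_zero]
      · exact hZ0
      · intro l _
        rw [if_neg (hemp (Finset.mem_univ l))]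
    obtain ⟨k, hk, hmin⟩ := Finset.exists_min_image _ a hne
    simp only [Finset.mem_filter, Finset.mem_univ, true_and] at hk hmin
    refine ⟨k, fun e => by rw [e] at hk; omega, (badCount_eq_of_notMem hk.le ?_).symm⟩
    intro i h1 h2
    have heq : ∀ l, (if i < a l then ε l else 0) = if a j < a l then ε l else 0 := by
      intro l
      have := hmin l
      congr 1
      simp only [eq_iff_iff]
      omega
    simpa only [heq] using hM

/-! ### Zeros of the real part of the exponent -/

variable {Ω : Type*} [MeasurableSpace Ω] {P : Measure Ω}
  {L : ℝ≥0 → ℝ≥0 → Ω → ℝ} {Ψ : ℝ → ℂ}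

lemma measurable_increment (hL : IsLevySheet P L Ψ) (s t s' t' : ℝ≥0) :
    Measurable (increment L s t s' t') := by
  unfold increment
  exact (((hL.measurable _ _).sub (hL.measurable _ _)).sub (hL.measurable _ _)).add
    (hL.measurable _ _)

lemma norm_exp_I_mul (ξ x : ℝ) : ‖Complex.exp (Complex.I * (ξ : ℂ) * (x : ℂ))‖ = 1 := by
  rw [show Complex.I * (ξ : ℂ) * (x : ℂ) = ((ξ * x : ℝ) : ℂ) * Complex.I by push_cast; ring]
  exact Complex.norm_exp_ofReal_mul_I _

lemma norm_integral_exp_unit (hL : IsLevySheet P L Ψ) (ξ : ℝ) :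
    ‖∫ ω, Complex.exp (Complex.I * (ξ : ℂ) * (increment L 0 0 1 1 ω : ℂ)) ∂P‖
      = Real.exp (-(Ψ ξ).re) := by
  rw [hL.charFun_increment 0 0 1 1 one_pos one_pos, Complex.norm_exp]
  simp

lemma re_exponent_nonneg [IsProbabilityMeasure P] (hL : IsLevySheet P L Ψ) (ξ : ℝ) : 0 ≤ (Ψ ξ).re := by
  have h := norm_integral_exp_unit hL ξ
  have h2 : ‖∫ ω, Complex.exp (Complex.I * (ξ : ℂ) * (increment L 0 0 1 1 ω : ℂ)) ∂P‖ ≤ 1 := by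
    refine (norm_integral_le_of_norm_le_const (C := 1) ?_).trans (by simp)
    exact Filter.Eventually.of_forall fun ω => (norm_exp_I_mul _ _).le
  rw [h, Real.exp_le_one_iff] at h2
  linarith

lemma re_exponent_zero [IsProbabilityMeasure P] (hL : IsLevySheet P L Ψ) : (Ψ 0).re = 0 := by
  have h := norm_integral_exp_unit hL 0
  simp only [Complex.ofReal_zero, mul_zero, zero_mul, Complex.exp_zero, integral_const,
    probReal_univ, one_smul, norm_one] at h
  have := Real.exp_eq_one_iff _ |>.1 h.symm
  linarith

/-- If the real part of the exponent vanishes at `ξ`, then `exp(i ξ X)` is almost surely constant,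
`X` being the increment on the unit square. -/
lemma exists_ae_eq_of_re_exponent_eq_zero [IsProbabilityMeasure P] (hL : IsLevySheet P L Ψ) {ξ : ℝ}
    (h : (Ψ ξ).re = 0) : ∃ c : ℂ, ∀ᵐ ω ∂P,
      Complex.exp (Complex.I * (ξ : ℂ) * (increment L 0 0 1 1 ω : ℂ)) = c := by
  -- Equality in `|E Y| ≤ 1` for a variable `Y` of modulus one forces `Y` to be constant.
  rcases ae_eq_const_or_norm_integral_lt_of_norm_le_const (μ := P) (C := 1)
    (f := fun ω => Complex.exp (Complex.I * (ξ : ℂ) * (increment L 0 0 1 1 ω : ℂ)))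
    (Filter.Eventually.of_forall fun ω => (norm_exp_I_mul _ _).le) with h1 | h1
  · exact ⟨_, h1⟩
  · rw [norm_integral_exp_unit hL, h] at h1
    simp at h1

/-- The zeros of the real part of the exponent are closed under differences. -/
lemma re_exponent_sub_eq_zero [IsProbabilityMeasure P] (hL : IsLevySheet P L Ψ) {ξ η : ℝ} (hξ : (Ψ ξ).re = 0)
    (hη : (Ψ η).re = 0) : (Ψ (ξ - η)).re = 0 := by
  obtain ⟨c, hc⟩ := exists_ae_eq_of_re_exponent_eq_zero hL hξ
  obtain ⟨d, hd⟩ := exists_ae_eq_of_re_exponent_eq_zero hL hη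
  have h : ∀ᵐ ω ∂P, Complex.exp (Complex.I * ((ξ - η : ℝ) : ℂ) * (increment L 0 0 1 1 ω : ℂ))
      = c / d := by
    filter_upwards [hc, hd] with ω h1 h2
    rw [← h1, ← h2, ← Complex.exp_sub]
    congr 1
    push_cast
    ring
  obtain ⟨ω, hω⟩ := h.exists
  have h1 := norm_integral_exp_unit hL (ξ - η)
  rw [integral_congr_ae h, integral_const, probReal_univ, one_smul, ← hω, norm_exp_I_mul] at h1
  have := Real.exp_eq_one_iff _ |>.1 h1.symm
  linarith

/-! ### Grids and characteristic functions of signed sums -/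

lemma exists_strictMono_grid (S : Finset ℝ≥0) :
    ∃ σ : ℕ → ℝ≥0, StrictMono σ ∧ σ 0 = 0 ∧ ∀ x ∈ S, ∃ i, σ i = x := by
  classical
  -- Unboundedness is added so that a new point always falls between two consecutive terms.
  suffices h : ∃ σ : ℕ → ℝ≥0, StrictMono σ ∧ σ 0 = 0 ∧ (∀ x, ∃ i, x < σ i) ∧
      ∀ x ∈ S, ∃ i, σ i = x by
    obtain ⟨σ, h1, h2, -, h3⟩ := h
    exact ⟨σ, h1, h2, h3⟩
  induction S using Finset.induction_on with
  | empty =>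
    exact ⟨fun i => i, Nat.strictMono_cast, by simp, fun x => exists_nat_gt x, by simp⟩
  | insert a S _ ih =>
    obtain ⟨σ, h1, h2, h3, h4⟩ := ih
    by_cases ha : ∃ i, σ i = a
    · refine ⟨σ, h1, h2, h3, fun x hx => ?_⟩
      rcases Finset.mem_insert.1 hx with rfl | hx
      · exact ha
      · exact h4 x hx
    push Not at ha
    obtain ⟨j, hj1, hj2⟩ : ∃ j, σ j < a ∧ a < σ (j + 1) := by
      have hpos : Nat.find (h3 a) ≠ 0 := by
        intro h
        have := Nat.find_spec (h3 a)
        rw [h, h2] at this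
        exact not_lt_bot this
      obtain ⟨j, hj⟩ := Nat.exists_eq_succ_of_ne_zero hpos
      refine ⟨j, ?_, ?_⟩
      · exact lt_of_le_of_ne (not_lt.1 (Nat.find_min (h3 a) (by omega))) (ha j)
      · have := Nat.find_spec (h3 a)
        rwa [hj] at this
    let σ' : ℕ → ℝ≥0 := fun k => if k ≤ j then σ k else if k = j + 1 then a else σ (k - 1)
    have hle : ∀ k, k ≤ j → σ' k = σ k := fun k hk => if_pos hk
    have heq : σ' (j + 1) = a := by simp [σ']
    have hgt : ∀ k, j + 1 ≤ k → σ' (k + 1) = σ k := fun k hk => by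
      simp only [σ']
      rw [if_neg (by omega), if_neg (by omega), Nat.add_sub_cancel]
    have hcov : ∀ k, ∃ i, σ' i = σ k := fun k => by
      by_cases hk : k ≤ j
      · exact ⟨k, hle k hk⟩
      · exact ⟨k + 1, hgt k (by omega)⟩
    refine ⟨σ', strictMono_nat_of_lt_succ fun k => ?_, ?_, fun x => ?_, fun x hx => ?_⟩
    · rcases lt_trichotomy k j with hk | rfl | hk
      · rw [hle k hk.le, hle (k + 1) hk]; exact h1 (Nat.lt_succ_self k)
      · rw [hle k le_rfl, heq]; exact hj1
      · rw [hgt k hk]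
        obtain ⟨l, rfl⟩ : ∃ l, k = l + 1 := ⟨k - 1, by omega⟩
        rcases Nat.eq_or_lt_of_le hk with hk' | hk'
        · obtain rfl : j = l := by omega
          rw [heq]; exact hj2
        · rw [hgt l (by omega)]; exact h1 (Nat.lt_succ_self l)
    · rw [hle 0 (Nat.zero_le _), h2]
    · obtain ⟨i, hi⟩ := h3 x
      obtain ⟨i', hi'⟩ := hcov i
      exact ⟨i', hi' ▸ hi⟩
    · rcases Finset.mem_insert.1 hx with rfl | hx
      · exact ⟨_, heq⟩
      · obtain ⟨i, hi⟩ := h4 x hx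
        obtain ⟨i', hi'⟩ := hcov i
        exact ⟨i', hi'.trans hi⟩

lemma sum_increment_grid {Ω : Type*} {L : ℝ≥0 → ℝ≥0 → Ω → ℝ} (σ τ : ℕ → ℝ≥0) (p q : ℕ) (ω : Ω) :
    ∑ i ∈ Finset.range p, ∑ k ∈ Finset.range q, increment L (σ i) (τ k) (σ (i + 1)) (τ (k + 1)) ω
      = L (σ p) (τ q) ω - L (σ 0) (τ q) ω - L (σ p) (τ 0) ω + L (σ 0) (τ 0) ω := by
  have h : ∀ i, ∑ k ∈ Finset.range q, increment L (σ i) (τ k) (σ (i + 1)) (τ (k + 1)) ω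
      = (L (σ (i + 1)) (τ q) ω - L (σ (i + 1)) (τ 0) ω) - (L (σ i) (τ q) ω - L (σ i) (τ 0) ω) := by
    intro i
    have := Finset.sum_range_sub (fun k => L (σ (i + 1)) (τ k) ω - L (σ i) (τ k) ω) q
    rw [show (L (σ (i + 1)) (τ q) ω - L (σ (i + 1)) (τ 0) ω) - (L (σ i) (τ q) ω - L (σ i) (τ 0) ω)
      = L (σ (i + 1)) (τ q) ω - L (σ i) (τ q) ω - (L (σ (i + 1)) (τ 0) ω - L (σ i) (τ 0) ω) by ring,
      ← this]
    refine Finset.sum_congr rfl fun k _ => ?_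
    unfold increment
    ring
  simp only [h]
  rw [Finset.sum_range_sub (fun i => L (σ i) (τ q) ω - L (σ i) (τ 0) ω)]
  ring

lemma iIndepFun_increment_grid (hL : IsLevySheet P L Ψ) {σ τ : ℕ → ℝ≥0} (hσ : StrictMono σ)
    (hτ : StrictMono τ) (p q : ℕ) :
    iIndepFun (fun c : Fin p × Fin q =>
      increment L (σ c.1) (τ c.2) (σ (c.1 + 1)) (τ (c.2 + 1))) P := by
  have h := hL.indep_increments (p * q)
    (fun k => σ (finProdFinEquiv.symm k).1) (fun k => τ (finProdFinEquiv.symm k).2)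
    (fun k => σ ((finProdFinEquiv.symm k).1 + 1)) (fun k => τ ((finProdFinEquiv.symm k).2 + 1))
    (fun k => hσ (Nat.lt_succ_self _)) (fun k => hτ (Nat.lt_succ_self _)) ?_
  · have h2 := h.precomp finProdFinEquiv.injective
    simpa using h2
  · intro k l hkl
    rw [Set.disjoint_prod]
    have hne : finProdFinEquiv.symm k ≠ finProdFinEquiv.symm l :=
      fun e => hkl (finProdFinEquiv.symm.injective e)
    rw [Ne, Prod.ext_iff, not_and_or] at hne
    rcases hne with hne | hne
    · left
      exact hσ.monotone.pairwise_disjoint_on_Ioc_succ (fun e => hne (Fin.ext e))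
    · right
      exact hτ.monotone.pairwise_disjoint_on_Ioc_succ (fun e => hne (Fin.ext e))

lemma norm_integral_exp_grid [IsProbabilityMeasure P] (hL : IsLevySheet P L Ψ) {σ τ : ℕ → ℝ≥0} (hσ : StrictMono σ)
    (hτ : StrictMono τ) (p q : ℕ) (c : ℕ → ℕ → ℝ) :
    ‖∫ ω, Complex.exp (Complex.I * ((∑ i ∈ Finset.range p, ∑ k ∈ Finset.range q,
        c i k * increment L (σ i) (τ k) (σ (i + 1)) (τ (k + 1)) ω : ℝ) : ℂ)) ∂P‖
      = Real.exp (-∑ i ∈ Finset.range p, ∑ k ∈ Finset.range q,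
        ((σ (i + 1) : ℝ) - σ i) * ((τ (k + 1) : ℝ) - τ k) * (Ψ (c i k)).re) := by
  have h := (iIndepFun_increment_grid hL hσ hτ p q).integral_fun_prod_comp (𝕜 := ℂ)
    (f := fun (d : Fin p × Fin q) (x : ℝ) => Complex.exp (Complex.I * (c d.1 d.2 : ℂ) * (x : ℂ)))
    (fun d => (measurable_increment hL _ _ _ _).aemeasurable)
    (fun d => Measurable.aestronglyMeasurable (by fun_prop))
  have h1 : ∀ ω, Complex.exp (Complex.I * ((∑ i ∈ Finset.range p, ∑ k ∈ Finset.range q,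
        c i k * increment L (σ i) (τ k) (σ (i + 1)) (τ (k + 1)) ω : ℝ) : ℂ)) =
      ∏ d : Fin p × Fin q, Complex.exp (Complex.I * (c d.1 d.2 : ℂ) *
        (increment L (σ d.1) (τ d.2) (σ (d.1 + 1)) (τ (d.2 + 1)) ω : ℂ)) := by
    intro ω
    rw [← Complex.exp_sum, Fintype.sum_prod_type]
    congr 1
    simp only [Finset.sum_range]
    push_cast
    rw [Finset.mul_sum]
    refine Finset.sum_congr rfl fun i _ => ?_
    rw [Finset.mul_sum]
    refine Finset.sum_congr rfl fun k _ => ?_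
    ring
  simp only [h1]
  rw [h, norm_prod]
  simp only [Finset.sum_range]
  rw [← Finset.sum_neg_distrib, Real.exp_sum, Fintype.prod_prod_type]
  refine Finset.prod_congr rfl fun i _ => ?_
  rw [← Finset.sum_neg_distrib, Real.exp_sum]
  refine Finset.prod_congr rfl fun k _ => ?_
  rw [hL.charFun_increment _ _ _ _ (hσ (Nat.lt_succ_self _)) (hτ (Nat.lt_succ_self _)),
    Complex.norm_exp, Complex.neg_re, Complex.re_ofReal_mul]

/-- Since the sheet vanishes on the axes, its value at a grid point is the sum of the increments
over the cells below and to the left. -/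
lemma sum_eq_ae_sum_increment (hL : IsLevySheet P L Ψ) {σ τ : ℕ → ℝ≥0} (hσ0 : σ 0 = 0)
    (hτ0 : τ 0 = 0) {ι : Type*} [Fintype ι] (a b : ι → ℕ) {p q : ℕ} (hp : ∀ j, a j ≤ p)
    (hq : ∀ j, b j ≤ q) (c : ι → ℝ) :
    ∀ᵐ ω ∂P, ∑ j, c j * L (σ (a j)) (τ (b j)) ω =
      ∑ i ∈ Finset.range p, ∑ k ∈ Finset.range q, (∑ j, if i < a j ∧ k < b j then c j else 0) *
        increment L (σ i) (τ k) (σ (i + 1)) (τ (k + 1)) ω := by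
  have h1 : ∀ᵐ ω ∂P, ∀ j, L 0 (τ (b j)) ω = 0 := ae_all_iff.2 fun j => hL.zero_left _
  have h2 : ∀ᵐ ω ∂P, ∀ j, L (σ (a j)) 0 ω = 0 := ae_all_iff.2 fun j => hL.zero_right _
  filter_upwards [h1, h2, hL.zero_left 0] with ω h1 h2 h3
  have h4 : ∀ j, c j * L (σ (a j)) (τ (b j)) ω = ∑ i ∈ Finset.range p, ∑ k ∈ Finset.range q,
      (if i < a j ∧ k < b j then c j else 0) *
        increment L (σ i) (τ k) (σ (i + 1)) (τ (k + 1)) ω := by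
    intro j
    have h5 : L (σ (a j)) (τ (b j)) ω = ∑ i ∈ Finset.range (a j), ∑ k ∈ Finset.range (b j),
        increment L (σ i) (τ k) (σ (i + 1)) (τ (k + 1)) ω := by
      rw [sum_increment_grid, hσ0, hτ0, h1, h2, h3]; ring
    rw [h5, Finset.mul_sum]
    have hi : Finset.range (a j) = (Finset.range p).filter (· < a j) := by
      ext i
      have := hp j
      simp only [Finset.mem_range, Finset.mem_filter]
      omega
    have hk : Finset.range (b j) = (Finset.range q).filter (· < b j) := by
      ext i
      have := hq j
      simp only [Finset.mem_range, Finset.mem_filter]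
      omega
    rw [hi, Finset.sum_filter]
    refine Finset.sum_congr rfl fun i _ => ?_
    by_cases hia : i < a j
    · rw [if_pos hia, hk, Finset.sum_filter, Finset.mul_sum]
      refine Finset.sum_congr rfl fun k _ => ?_
      by_cases hkb : k < b j <;> simp [hia, hkb]
    · simp [hia]
  simp only [h4]
  rw [Finset.sum_comm]
  refine Finset.sum_congr rfl fun i _ => ?_
  rw [Finset.sum_comm]
  refine Finset.sum_congr rfl fun k _ => ?_
  rw [Finset.sum_mul]

/-! ### Exponential decay of the characteristic function -/

/-- Positive values of `Re Ψ` at bounded multiples of `θ` are bounded below. -/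
lemma exists_pos_le_re_exponent [IsProbabilityMeasure P] (hL : IsLevySheet P L Ψ) (θ : ℝ) (M : ℕ) :
    ∃ α : ℝ, 0 < α ∧ ∀ v : ℤ, |v| ≤ M → (Ψ (θ * v)).re ≠ 0 → α ≤ (Ψ (θ * v)).re := by
  classical
  rcases ((Finset.Icc (-(M : ℤ)) M).filter fun v : ℤ => (Ψ (θ * v)).re ≠ 0).eq_empty_or_nonempty
    with h | h
  · rw [Finset.filter_eq_empty_iff] at h
    refine ⟨1, one_pos, fun v hv hv' => ?_⟩
    exact absurd hv' (h (Finset.mem_Icc.2 (abs_le.1 hv)))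
  · obtain ⟨v, hv, hmin⟩ := Finset.exists_min_image _ (fun v : ℤ => (Ψ (θ * v)).re) h
    refine ⟨_, (re_exponent_nonneg hL _).lt_of_ne' (Finset.mem_filter.1 hv).2, fun w hw hw' => ?_⟩
    exact hmin w (Finset.mem_filter.2 ⟨Finset.mem_Icc.2 (abs_le.1 hw), hw'⟩)

lemma abs_sum_ite_le {ι : Type*} [Fintype ι] (ε : ι → ℤ) (hε : ∀ j, |ε j| ≤ 1) (Q : ι → Prop)
    [DecidablePred Q] : |∑ j, if Q j then ε j else 0| ≤ (Fintype.card ι : ℤ) := by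
  refine (Finset.abs_sum_le_sum_abs _ _).trans ?_
  refine (Finset.sum_le_card_nsmul _ _ 1 fun j _ => ?_).trans (by simp)
  split_ifs
  · exact hε j
  · simp

/-- The key one-dimensional estimate: a stretch of the grid along which the walk avoids the zeros
of the exponent is controlled by the weighted sum of the exponent. -/
lemma mul_abs_sub_le_sum {ι : Type*} [Fintype ι] {a : ι → ℕ} {ε : ι → ℤ} {g : ℤ → ℝ}
    {α : ℝ} (hg : ∀ v, 0 ≤ g v)
    (hα : ∀ i, g (∑ j, if i < a j then ε j else 0) ≠ 0 →
      α ≤ g (∑ j, if i < a j then ε j else 0))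
    {σ : ℕ → ℝ≥0} (hσ : StrictMono σ) {p : ℕ} (hp : ∀ j, a j ≤ p) {j k : ι}
    (h : badCount a ε {v | g v = 0} (a j) = badCount a ε {v | g v = 0} (a k)) :
    α * |(σ (a j) : ℝ) - σ (a k)| ≤
      ∑ i ∈ Finset.range p, ((σ (i + 1) : ℝ) - σ i) * g (∑ j, if i < a j then ε j else 0) := by
  wlog hjk : a j ≤ a k generalizing j k
  · rw [abs_sub_comm]
    exact this h.symm (le_of_not_ge hjk)
  have hσm : ∀ i, (0 : ℝ) ≤ (σ (i + 1) : ℝ) - σ i := fun i =>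
    sub_nonneg.2 (NNReal.coe_le_coe.2 (hσ.monotone (Nat.le_succ i)))
  rw [abs_sub_comm, abs_of_nonneg (sub_nonneg.2 (NNReal.coe_le_coe.2 (hσ.monotone hjk))),
    ← Finset.sum_Ico_sub (fun i => (σ i : ℝ)) hjk, Finset.mul_sum]
  have hsub : Finset.Ico (a j) (a k) ⊆ Finset.range p := by
    intro i hi
    have := hp k
    simp only [Finset.mem_Ico, Finset.mem_range] at *
    omega
  refine le_trans (Finset.sum_le_sum fun i hi => ?_)
    (Finset.sum_le_sum_of_subset_of_nonneg hsub fun i _ _ => mul_nonneg (hσm i) (hg _))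
  rw [mul_comm]
  refine mul_le_mul_of_nonneg_left (hα i ?_) (hσm i)
  exact notMem_of_badCount_eq h (Finset.mem_Ico.1 hi).1 (Finset.mem_Ico.1 hi).2

/-- Restricting a double sum to the strip below all second indices. -/
lemma strip_sum_le {ι : Type*} [Fintype ι] {a b : ι → ℕ} {ε : ι → ℤ} {g : ℤ → ℝ}
    (hg : ∀ v, 0 ≤ g v) {σ τ : ℕ → ℝ≥0} (hσ : StrictMono σ) (hτ : StrictMono τ) (hτ0 : τ 0 = 0)
    {p q r : ℕ} (hr : ∀ j, r ≤ b j) (hrq : r ≤ q) :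
    τ r * ∑ i ∈ Finset.range p, ((σ (i + 1) : ℝ) - σ i) * g (∑ j, if i < a j then ε j else 0) ≤
      ∑ i ∈ Finset.range p, ∑ k ∈ Finset.range q, ((σ (i + 1) : ℝ) - σ i) *
        ((τ (k + 1) : ℝ) - τ k) * g (∑ j, if i < a j ∧ k < b j then ε j else 0) := by
  have hσm : ∀ i, (0 : ℝ) ≤ (σ (i + 1) : ℝ) - σ i := fun i =>
    sub_nonneg.2 (NNReal.coe_le_coe.2 (hσ.monotone (Nat.le_succ i)))
  have hτm : ∀ i, (0 : ℝ) ≤ (τ (i + 1) : ℝ) - τ i := fun i =>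
    sub_nonneg.2 (NNReal.coe_le_coe.2 (hτ.monotone (Nat.le_succ i)))
  rw [Finset.mul_sum]
  refine Finset.sum_le_sum fun i _ => ?_
  refine le_trans (le_of_eq ?_) (Finset.sum_le_sum_of_subset_of_nonneg
    (Finset.range_subset_range.2 hrq)
    fun k _ _ => mul_nonneg (mul_nonneg (hσm i) (hτm k)) (hg _))
  have h1 : (τ r : ℝ) = ∑ k ∈ Finset.range r, ((τ (k + 1) : ℝ) - τ k) := by
    rw [Finset.sum_range_sub (fun k => (τ k : ℝ)), hτ0]; simp
  rw [h1, Finset.sum_mul]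
  refine Finset.sum_congr rfl fun k hk => ?_
  -- Below level `r` the condition on the second index always holds, so the coefficient is the
  -- one-dimensional walk.
  have h2 : ∀ j, (i < a j ∧ k < b j) ↔ i < a j := fun j =>
    and_iff_left ((Finset.mem_range.1 hk).trans_le (hr j))
  simp only [h2]
  ring

/-- Bound for the characteristic function of a balanced signed sum of values of the sheet:
there is a `2`-colouring such that each point is matched, in each coordinate, to a point of
the other colour, the distances being controlled by the exponential decay. -/
lemma exists_coloring_norm_integral_exp_le [IsProbabilityMeasure P] (hL : IsLevySheet P L Ψ)
    {θ : ℝ} (hθ : (Ψ θ).re ≠ 0) {ι : Type*} [Fintype ι] {ε : ι → ℤ} (hε : ∀ j, ε j = 1 ∨ ε j = -1)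
    (hε0 : ∑ j, ε j = 0) {α : ℝ}
    (hα : ∀ v : ℤ, |v| ≤ Fintype.card ι → (Ψ (θ * v)).re ≠ 0 → α ≤ (Ψ (θ * v)).re)
    {s₀ x₀ : ℝ≥0} (hs₀ : 0 < s₀) (hx₀ : 0 < x₀) (s x : ι → ℝ≥0)
    (hs : ∀ j, s₀ ≤ s j) (hx : ∀ j, x₀ ≤ x j) :
    ∃ (χ : ι → Bool) (π ρ : ι → ι), (∀ j, χ (π j) ≠ χ j) ∧ (∀ j, χ (ρ j) ≠ χ j) ∧
      ∀ j, ‖∫ ω, Complex.exp (Complex.I * ((θ * ∑ j, ε j * L (s j) (x j) ω : ℝ) : ℂ)) ∂P‖ ≤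
        Real.exp (-(α / 2 * (x₀ * |(s j : ℝ) - s (π j)| + s₀ * |(x j : ℝ) - x (ρ j)|))) := by
  classical
  obtain ⟨σ, hσ, hσ0, hσS⟩ := exists_strictMono_grid (insert s₀ (Finset.univ.image s))
  obtain ⟨τ, hτ, hτ0, hτS⟩ := exists_strictMono_grid (insert x₀ (Finset.univ.image x))
  obtain ⟨a₀, ha₀⟩ := hσS s₀ (Finset.mem_insert_self _ _)
  obtain ⟨b₀, hb₀⟩ := hτS x₀ (Finset.mem_insert_self _ _)
  have hsa : ∀ j, ∃ i, σ i = s j := fun j => hσS _ (Finset.mem_insert_of_mem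
    (Finset.mem_image_of_mem _ (Finset.mem_univ j)))
  have hxb : ∀ j, ∃ i, τ i = x j := fun j => hτS _ (Finset.mem_insert_of_mem
    (Finset.mem_image_of_mem _ (Finset.mem_univ j)))
  choose a ha using hsa
  choose b hb using hxb
  have haa : ∀ j, a₀ ≤ a j := fun j => hσ.le_iff_le.1 (by rw [ha, ha₀]; exact hs j)
  have hbb : ∀ j, b₀ ≤ b j := fun j => hτ.le_iff_le.1 (by rw [hb, hb₀]; exact hx j)
  have ha₀p : 0 < a₀ := hσ.lt_iff_lt.1 (by rw [ha₀, hσ0]; exact hs₀)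
  have hb₀p : 0 < b₀ := hτ.lt_iff_lt.1 (by rw [hb₀, hτ0]; exact hx₀)
  let p := a₀ + ∑ j, a j
  let q := b₀ + ∑ j, b j
  have hp : ∀ j, a j ≤ p := fun j =>
    (Finset.single_le_sum (fun i _ => Nat.zero_le (a i)) (Finset.mem_univ j)).trans
      (Nat.le_add_left _ _)
  have hq : ∀ j, b j ≤ q := fun j =>
    (Finset.single_le_sum (fun i _ => Nat.zero_le (b i)) (Finset.mem_univ j)).trans
      (Nat.le_add_left _ _)
  let g : ℤ → ℝ := fun v => (Ψ (θ * v)).re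
  have hg : ∀ v, 0 ≤ g v := fun v => re_exponent_nonneg hL _
  have hε1 : ∀ j, |ε j| ≤ 1 := fun j => by rcases hε j with h | h <;> simp [h]
  have hgα : ∀ (Q : ι → Prop) [DecidablePred Q], g (∑ j, if Q j then ε j else 0) ≠ 0 →
      α ≤ g (∑ j, if Q j then ε j else 0) := fun Q _ h => hα _ (abs_sum_ite_le ε hε1 Q) h
  let Z : Set ℤ := {v | g v = 0}
  have hg0 : g 0 = 0 := by simp [g, re_exponent_zero hL]
  have hgsub : ∀ v w, g v = 0 → g w = 0 → g (v - w) = 0 := by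
    intro v w hv hw
    have := re_exponent_sub_eq_zero hL hv hw
    simp only [g]
    push_cast
    rwa [mul_sub]
  have hg1 : g 1 ≠ 0 := by simpa [g] using hθ
  -- Two zeros differing by `±1` would make `1` a zero, against `a(θ) ≠ 0`.
  have hZ : ∀ v j, v ∈ Z → v + ε j ∉ Z := by
    intro v j hv hv'
    have h1 : g (ε j) = 0 := by simpa using hgsub _ _ hv' hv
    rcases hε j with h | h
    · rw [h] at h1; exact hg1 h1
    · rw [h] at h1
      exact hg1 (by simpa using hgsub _ _ hg0 h1)
  obtain ⟨χ, h1, h2⟩ := exists_coloring_of_setoids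
    (Setoid.ker fun j => badCount a ε Z (a j)) (Setoid.ker fun j => badCount b ε Z (b j))
    (exists_ne_badCount_eq a ε Z hε0 hg0 hZ fun j => ha₀p.trans_le (haa j))
    (exists_ne_badCount_eq b ε Z hε0 hg0 hZ fun j => hb₀p.trans_le (hbb j))
  choose π hπ hπ' using h1
  choose ρ hρ hρ' using h2
  refine ⟨χ, π, ρ, hπ', hρ', fun j => ?_⟩
  have hae : ∀ᵐ ω ∂P, Complex.exp (Complex.I * ((θ * ∑ j, ε j * L (s j) (x j) ω : ℝ) : ℂ)) =
      Complex.exp (Complex.I * ((∑ i ∈ Finset.range p, ∑ k ∈ Finset.range q,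
        (θ * ((∑ j, if i < a j ∧ k < b j then ε j else 0 : ℤ) : ℝ)) *
          increment L (σ i) (τ k) (σ (i + 1)) (τ (k + 1)) ω : ℝ) : ℂ)) := by
    filter_upwards [sum_eq_ae_sum_increment hL hσ0 hτ0 a b hp hq (fun j => (ε j : ℝ))] with ω hω
    simp only [← ha, ← hb]
    rw [hω, Finset.mul_sum]
    congr 3
    refine Finset.sum_congr rfl fun i _ => ?_
    rw [Finset.mul_sum]
    refine Finset.sum_congr rfl fun k _ => ?_
    push_cast
    ring
  rw [integral_congr_ae hae, norm_integral_exp_grid hL hσ hτ p q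
    (fun i k => θ * ((∑ j, if i < a j ∧ k < b j then ε j else 0 : ℤ) : ℝ)), Real.exp_le_exp,
    neg_le_neg_iff]
  have hsx : α * |(s j : ℝ) - s (π j)| ≤ _ :=
    ha j ▸ ha (π j) ▸ mul_abs_sub_le_sum hg (fun i => hgα _) hσ hp (hπ j).symm
  have hxx : α * |(x j : ℝ) - x (ρ j)| ≤ _ :=
    hb j ▸ hb (ρ j) ▸ mul_abs_sub_le_sum hg (fun i => hgα _) hτ hq (hρ j).symm
  have hS1 := strip_sum_le (ε := ε) (a := a) (p := p) hg hσ hτ hτ0 hbb (Nat.le_add_right b₀ _ : b₀ ≤ q)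
  have hS2 := strip_sum_le (ε := ε) (a := b) (p := q) hg hτ hσ hσ0 haa (Nat.le_add_right a₀ _ : a₀ ≤ p)
  rw [hb₀] at hS1
  rw [ha₀, Finset.sum_comm] at hS2
  have hS3 := (mul_le_mul_of_nonneg_left hsx x₀.2).trans hS1
  have hS4 := (mul_le_mul_of_nonneg_left hxx s₀.2).trans hS2
  have hcomm : ∀ i k, ((τ (k + 1) : ℝ) - τ k) * ((σ (i + 1) : ℝ) - σ i) *
      g (∑ j, if k < b j ∧ i < a j then ε j else 0) = ((σ (i + 1) : ℝ) - σ i) *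
        ((τ (k + 1) : ℝ) - τ k) * g (∑ j, if i < a j ∧ k < b j then ε j else 0) := by
    intro i k
    simp only [and_comm]
    ring
  simp only [hcomm] at hS4
  simp only [g, NNReal.val_eq_coe] at hS3 hS4
  -- The exponent dominates each of the two strip bounds, hence their average; this is the factor
  -- `1/2`.
  linarith

/-! ### Integrals over two-coloured index sets -/

lemma lintegral_fin_prod_eq_prod {E : Type*} [MeasurableSpace E] {μ : Measure E} [SigmaFinite μ]
    {n : ℕ} (f : Fin n → E → ENNReal) (hf : ∀ i, Measurable (f i)) :
    ∫⁻ x : Fin n → E, ∏ i, f i (x i) ∂(Measure.pi fun _ => μ) = ∏ i, ∫⁻ x, f i x ∂μ := by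
  induction n with
  | zero => simp
  | succ n ih =>
    rw [← ((measurePreserving_piFinSuccAbove (fun _ => μ) 0).symm).lintegral_comp_emb
      (MeasurableEquiv.measurableEmbedding _)]
    simp_rw [MeasurableEquiv.piFinSuccAbove_symm_apply, Fin.insertNthEquiv,
      Fin.prod_univ_succ, Fin.insertNth_zero, Equiv.coe_fn_mk, Fin.cons_succ, Fin.cons_zero]
    rw [← ih _ fun i => hf i.succ]
    rw [← lintegral_prod_mul (hf 0).aemeasurable]
    · rfl
    · exact (Finset.measurable_prod _ fun i _ => (hf i.succ).comp (measurable_pi_apply i)).aemeasurable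

lemma lintegral_fintype_prod_eq_prod {E : Type*} [MeasurableSpace E] {μ : Measure E}
    [SigmaFinite μ] {ι : Type*} [Fintype ι] (f : ι → E → ENNReal) (hf : ∀ i, Measurable (f i)) :
    ∫⁻ x : ι → E, ∏ i, f i (x i) ∂(Measure.pi fun _ => μ) = ∏ i, ∫⁻ x, f i x ∂μ := by
  let e := (Fintype.equivFin ι).symm
  rw [← (measurePreserving_piCongrLeft (fun _ => μ) e).lintegral_comp_emb
    (MeasurableEquiv.measurableEmbedding _)]
  simp_rw [← e.prod_comp, MeasurableEquiv.coe_piCongrLeft, Equiv.piCongrLeft_apply_apply]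
  exact lintegral_fin_prod_eq_prod _ fun i => hf _

/-- With the variables in `p` frozen, those outside `p` separate, because each kernel contains only
one of them; each contributes at most `D`. -/
lemma lintegral_prod_bipartite_le {E : Type*} [MeasurableSpace E] {μ : Measure E}
    [SigmaFinite μ] {ι : Type*} [Fintype ι] {p : ι → Prop} [DecidablePred p] {π ρ : ι → ι}
    (hπ : ∀ j, ¬ p j → p (π j)) (hρ : ∀ j, ¬ p j → p (ρ j)) {G : E → ENNReal}
    (hG : Measurable G) {κ : E × E × E → ENNReal} (hκ : Measurable κ) {D : ENNReal}
    (hD : ∀ u v, ∫⁻ z, κ (z, u, v) ∂μ ≤ D) :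
    ∫⁻ z : ι → E, (∏ j : {j // p j}, G (z j)) * ∏ j : {j // ¬ p j}, κ (z j, z (π j), z (ρ j))
      ∂(Measure.pi fun _ => μ) ≤
      (∫⁻ z, G z ∂μ) ^ Fintype.card {j // p j} * D ^ Fintype.card {j // ¬ p j} := by
  rw [← ((measurePreserving_piEquivPiSubtypeProd (fun _ : ι => μ) p).symm).lintegral_comp_emb
      (MeasurableEquiv.measurableEmbedding _)]
  have hsymm1 : ∀ (w : ({j // p j} → E) × ({j // ¬ p j} → E)) (j : ι) (hj : p j),
      (MeasurableEquiv.piEquivPiSubtypeProd (fun _ => E) p).symm w j = w.1 ⟨j, hj⟩ := by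
    intro w j hj
    exact dif_pos hj
  have hsymm2 : ∀ (w : ({j // p j} → E) × ({j // ¬ p j} → E)) (j : ι) (hj : ¬ p j),
      (MeasurableEquiv.piEquivPiSubtypeProd (fun _ => E) p).symm w j = w.2 ⟨j, hj⟩ := by
    intro w j hj
    exact dif_neg hj
  have hF : ∀ w : ({j // p j} → E) × ({j // ¬ p j} → E),
      (∏ j : {j // p j}, G ((MeasurableEquiv.piEquivPiSubtypeProd (fun _ => E) p).symm w j)) *
        ∏ j : {j // ¬ p j}, κ ((MeasurableEquiv.piEquivPiSubtypeProd (fun _ => E) p).symm w j,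
          (MeasurableEquiv.piEquivPiSubtypeProd (fun _ => E) p).symm w (π j),
          (MeasurableEquiv.piEquivPiSubtypeProd (fun _ => E) p).symm w (ρ j)) =
      (∏ j, G (w.1 j)) * ∏ j : {j // ¬ p j},
        κ (w.2 j, w.1 ⟨π j, hπ j j.2⟩, w.1 ⟨ρ j, hρ j j.2⟩) := by
    intro w
    congr 1
    · exact Finset.prod_congr rfl fun j _ => by rw [hsymm1 w j j.2]
    · exact Finset.prod_congr rfl fun j _ => by
        rw [hsymm2 w j j.2, hsymm1 w _ (hπ j j.2), hsymm1 w _ (hρ j j.2)]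
  simp only [hF]
  rw [lintegral_prod _ (by fun_prop)]
  calc _ ≤ ∫⁻ x : {j // p j} → E, (∏ j, G (x j)) * D ^ Fintype.card {j // ¬ p j}
        ∂(Measure.pi fun _ => μ) := by
        refine lintegral_mono fun x => ?_
        simp only
        rw [lintegral_const_mul _ (by fun_prop)]
        refine mul_le_mul_right ?_ _
        rw [lintegral_fintype_prod_eq_prod
          (fun (j : {j // ¬ p j}) z => κ (z, x ⟨π j, hπ j j.2⟩, x ⟨ρ j, hρ j j.2⟩))
          (fun j => by fun_prop)]
        exact (Finset.prod_le_prod' fun j _ => hD _ _).trans (by simp)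
    _ = _ := by
        rw [lintegral_mul_const _ (by fun_prop),
          lintegral_fintype_prod_eq_prod (fun (_ : {j // p j}) => G) (fun _ => hG)]
        simp

/-- Integrals of products over a `2`-coloured index set, where each variable is tied to two
variables of the other colour by a kernel. -/
lemma lintegral_prod_mul_kernel_sq_le {E : Type*} [MeasurableSpace E] {μ : Measure E}
    [SigmaFinite μ] {ι : Type*} [Fintype ι] {χ : ι → Bool} {π ρ : ι → ι}
    (hπ : ∀ j, χ (π j) ≠ χ j) (hρ : ∀ j, χ (ρ j) ≠ χ j) {G : E → ENNReal}
    (hG : Measurable G) {κ : E × E × E → ENNReal} (hκ : Measurable κ) {D : ENNReal}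
    (hD : ∀ u v, ∫⁻ z, κ (z, u, v) ^ 2 ∂μ ≤ D) :
    (∫⁻ z : ι → E, ∏ j, (G (z j) * κ (z j, z (π j), z (ρ j))) ∂(Measure.pi fun _ => μ)) ^ 2 ≤
      ((∫⁻ z, G z ^ 2 ∂μ) * D) ^ Fintype.card ι := by
  -- `U b` takes the weights of colour `b` and the kernels of the other colour, so that each squared
  -- factor has the bipartite form.
  let U : Bool → (ι → E) → ENNReal := fun b z =>
    (∏ j : {j // χ j = b}, G (z j)) * ∏ j : {j // ¬ χ j = b}, κ (z j, z (π j), z (ρ j))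
  have hU : ∀ b, Measurable (U b) := by
    intro b
    simp only [U]
    fun_prop
  have hsplit : ∀ z : ι → E, ∏ j, (G (z j) * κ (z j, z (π j), z (ρ j))) =
      (U true * U false) z := by
    intro z
    simp only [Pi.mul_apply, U]
    rw [Finset.prod_mul_distrib,
      ← Fintype.prod_subtype_mul_prod_subtype (fun j => χ j = true) (fun j => G (z j)),
      ← Fintype.prod_subtype_mul_prod_subtype (fun j => χ j = false)
        (fun j => κ (z j, z (π j), z (ρ j)))]
    have e1 : (∏ j : {j // ¬ χ j = true}, G (z j)) = ∏ j : {j // χ j = false}, G (z j) :=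
      Fintype.prod_equiv (Equiv.subtypeEquivRight fun j => by simp) _ _ fun j => rfl
    have e2 : (∏ j : {j // ¬ χ j = false}, κ (z j, z (π j), z (ρ j))) =
        ∏ j : {j // χ j = true}, κ (z j, z (π j), z (ρ j)) :=
      Fintype.prod_equiv (Equiv.subtypeEquivRight fun j => by simp) _ _ fun j => rfl
    have e3 : (∏ j : {j // ¬ χ j = true}, κ (z j, z (π j), z (ρ j))) =
        ∏ j : {j // χ j = false}, κ (z j, z (π j), z (ρ j)) :=
      Fintype.prod_equiv (Equiv.subtypeEquivRight fun j => by simp) _ _ fun j => rfl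
    rw [e1, e2, e3]
    ring
  have hbound : ∀ b : Bool, ∫⁻ z, U b z ^ 2 ∂(Measure.pi fun _ => μ) ≤
      (∫⁻ z, G z ^ 2 ∂μ) ^ Fintype.card {j // χ j = b} * D ^ Fintype.card {j // ¬ χ j = b} := by
    intro b
    have := lintegral_prod_bipartite_le (μ := μ) (p := fun j => χ j = b) (π := π) (ρ := ρ)
      (fun j hj => by
        have := hπ j
        revert this hj; cases χ j <;> cases χ (π j) <;> cases b <;> simp)
      (fun j hj => by
        have := hρ j
        revert this hj; cases χ j <;> cases χ (ρ j) <;> cases b <;> simp)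
      (G := fun z => G z ^ 2) (κ := fun z => κ z ^ 2) (by fun_prop) (by fun_prop) hD
    refine le_trans (le_of_eq ?_) this
    refine lintegral_congr fun z => ?_
    simp only [U, mul_pow, Finset.prod_pow]
  simp only [hsplit]
  have hH := ENNReal.lintegral_mul_le_Lp_mul_Lq (Measure.pi fun _ => μ)
    Real.HolderConjugate.two_two (hU true).aemeasurable
    (hU false).aemeasurable
  have hsq : ∀ a : ENNReal, (a ^ (1 / 2 : ℝ)) ^ 2 = a := by
    intro a
    rw [← ENNReal.rpow_natCast, ← ENNReal.rpow_mul]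
    norm_num
  refine (pow_le_pow_left' hH 2).trans ?_
  rw [mul_pow, hsq, hsq]
  simp only [ENNReal.rpow_ofNat]
  refine (mul_le_mul' (hbound true) (hbound false)).trans (le_of_eq ?_)
  have c1 : Fintype.card {j // ¬ χ j = true} = Fintype.card {j // χ j = false} :=
    Fintype.card_congr (Equiv.subtypeEquivRight fun j => by simp)
  have c2 : Fintype.card {j // ¬ χ j = false} = Fintype.card {j // χ j = true} :=
    Fintype.card_congr (Equiv.subtypeEquivRight fun j => by simp)
  have c3 : Fintype.card ι = Fintype.card {j // χ j = true} + Fintype.card {j // χ j = false} := by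
    rw [← c1, Fintype.card_subtype_compl, Nat.add_sub_cancel' (Fintype.card_subtype_le _)]
  rw [c1, c2, c3]
  ring

/-! ### The exponential kernel -/

lemma lintegral_exp_neg_mul_abs_sub_le {c : ℝ} (hc : 0 < c) (u : ℝ) :
    ∫⁻ x : ℝ, ENNReal.ofReal (Real.exp (-(c * |x - u|))) = ENNReal.ofReal (2 / c) := by
  have h1 : ∫⁻ x : ℝ, ENNReal.ofReal (Real.exp (-(c * |x - u|))) =
      ∫⁻ x : ℝ, ENNReal.ofReal (Real.exp (-(c * |x|))) :=
    lintegral_sub_right_eq_self (fun x => ENNReal.ofReal (Real.exp (-(c * |x|)))) u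
  have h2 : ∫ x : ℝ, Real.exp (-(c * |x|)) = 2 / c := by
    rw [integral_comp_abs (f := fun x => Real.exp (-(c * x)))]
    have := integral_exp_mul_Ioi (a := -c) (by linarith) 0
    simp only [neg_mul, mul_zero, Real.exp_zero] at this
    rw [this]
    field_simp
  have hI : Integrable (fun x : ℝ => Real.exp (-(c * |x|))) :=
    .of_integral_ne_zero (by rw [h2]; positivity)
  rw [h1, ← ofReal_integral_eq_lintegral_ofReal hI
    (Filter.Eventually.of_forall fun x => (Real.exp_pos _).le), h2]

/-- The kernel `(z, u, v) ↦ exp(-c |z₁ - u₁|) exp(-d |z₂ - v₂|)`. -/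
noncomputable def expKernel (c d : ℝ) (p : (ℝ × ℝ) × (ℝ × ℝ) × (ℝ × ℝ)) : ENNReal :=
  ENNReal.ofReal (Real.exp (-(c * |p.1.1 - p.2.1.1|))) *
    ENNReal.ofReal (Real.exp (-(d * |p.1.2 - p.2.2.2|)))

lemma measurable_expKernel (c d : ℝ) : Measurable (expKernel c d) := by
  unfold expKernel
  fun_prop

lemma lintegral_expKernel_sq_le {c d : ℝ} (hc : 0 < c) (hd : 0 < d) (S : Set (ℝ × ℝ))
    (u v : ℝ × ℝ) : ∫⁻ z, expKernel c d (z, u, v) ^ 2 ∂(volume.restrict S) ≤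
      ENNReal.ofReal (1 / c * (1 / d)) := by
  refine (lintegral_mono' Measure.restrict_le_self le_rfl).trans (le_of_eq ?_)
  have h : ∀ z : ℝ × ℝ, expKernel c d (z, u, v) ^ 2 =
      ENNReal.ofReal (Real.exp (-(2 * c * |z.1 - u.1|))) *
        ENNReal.ofReal (Real.exp (-(2 * d * |z.2 - v.2|))) := by
    intro z
    unfold expKernel
    rw [mul_pow, ← ENNReal.ofReal_pow (Real.exp_pos _).le, ← ENNReal.ofReal_pow (Real.exp_pos _).le,
      ← Real.exp_nat_mul, ← Real.exp_nat_mul]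
    congr 3 <;> · push_cast; ring
  simp only [h]
  rw [Measure.volume_eq_prod, lintegral_prod_mul
      (f := fun a => ENNReal.ofReal (Real.exp (-(2 * c * |a - u.1|))))
      (g := fun a => ENNReal.ofReal (Real.exp (-(2 * d * |a - v.2|))))
      (by fun_prop) (by fun_prop),
    lintegral_exp_neg_mul_abs_sub_le (by positivity), lintegral_exp_neg_mul_abs_sub_le (by positivity),
    ← ENNReal.ofReal_mul (by positivity)]
  congr 1
  field_simp

/-- A geometric mean of the bounds. The denominator is the cardinality plus one so that it never
vanishes; `y ≤ 1` absorbs the extra factor. -/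
lemma le_prod_exp_div {ι : Type*} [Fintype ι] {y : ℝ} (hy0 : 0 ≤ y) (hy1 : y ≤ 1) {A : ι → ℝ}
    (hA : ∀ j, y ≤ Real.exp (-A j)) :
    y ≤ ∏ j, Real.exp (-(A j / (Fintype.card ι + 1))) := by
  rw [← pow_le_pow_iff_left₀ hy0 (Finset.prod_nonneg fun j _ => (Real.exp_pos _).le)
    (Nat.succ_ne_zero (Fintype.card ι)), ← Finset.prod_pow]
  have h1 : ∀ j, Real.exp (-(A j / (Fintype.card ι + 1))) ^ (Fintype.card ι).succ =
      Real.exp (-A j) := by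
    intro j
    rw [← Real.exp_nat_mul]
    congr 1
    push_cast
    field_simp
  simp only [h1, pow_succ]
  calc y ^ Fintype.card ι * y ≤ y ^ Fintype.card ι := mul_le_of_le_one_right (by positivity) hy1
    _ = ∏ _j : ι, y := by simp
    _ ≤ _ := Finset.prod_le_prod (fun _ _ => hy0) fun j _ => hA j

/-- Triples `(χ, π, ρ)` of a `2`-colouring and two maps sending each point to one of the other
colour. -/
noncomputable def oppositeMaps (ι : Type*) [Fintype ι] :
    Finset ((ι → Bool) × (ι → ι) × (ι → ι)) := by
  classical
  exact Finset.univ.filter fun t =>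
    (∀ j, t.1 (t.2.1 j) ≠ t.1 j) ∧ (∀ j, t.1 (t.2.2 j) ≠ t.1 j)

lemma mem_oppositeMaps {ι : Type*} [Fintype ι] {t : (ι → Bool) × (ι → ι) × (ι → ι)} :
    t ∈ oppositeMaps ι ↔ (∀ j, t.1 (t.2.1 j) ≠ t.1 j) ∧ (∀ j, t.1 (t.2.2 j) ≠ t.1 j) := by
  simp [oppositeMaps]

/-- The colouring and the matchings depend on `z`; summing over all possible triples removes this
dependence before integrating. The two factors `√n`, from the strip width and from the distance,
combine to `n`. -/
lemma enorm_integral_exp_le_sum [IsProbabilityMeasure P] (hL : IsLevySheet P L Ψ)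
    {θ : ℝ} (hθ : (Ψ θ).re ≠ 0) {ι : Type*} [Fintype ι] {ε : ι → ℤ} (hε : ∀ j, ε j = 1 ∨ ε j = -1)
    (hε0 : ∑ j, ε j = 0) {α : ℝ}
    (hα : ∀ v : ℤ, |v| ≤ Fintype.card ι → (Ψ (θ * v)).re ≠ 0 → α ≤ (Ψ (θ * v)).re)
    {s₀ x₀ : ℝ} (hs₀ : 0 < s₀) (hx₀ : 0 < x₀) {n : ℕ} (hn : 1 ≤ n) (z : ι → ℝ × ℝ)
    (hs : ∀ j, s₀ ≤ (z j).1) (hx : ∀ j, x₀ ≤ (z j).2) :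
    ‖∫ ω, Complex.exp (Complex.I * ((∑ j, ε j * (θ * L (Real.toNNReal (√(n : ℝ) * (z j).1))
      (Real.toNNReal (√(n : ℝ) * (z j).2)) ω) : ℝ) : ℂ)) ∂P‖ₑ ≤
    ∑ t ∈ oppositeMaps ι,
      ∏ j, expKernel (α * n / (2 * (Fintype.card ι + 1)) * x₀)
        (α * n / (2 * (Fintype.card ι + 1)) * s₀) (z j, z (t.2.1 j), z (t.2.2 j)) := by
  have hn0 : (0 : ℝ) < n := by exact_mod_cast hn
  have hr : 0 < √(n : ℝ) := Real.sqrt_pos.2 hn0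
  have hrr : √(n : ℝ) * √(n : ℝ) = n := Real.mul_self_sqrt hn0.le
  obtain ⟨χ, π, ρ, hπ, hρ, h⟩ := exists_coloring_norm_integral_exp_le hL hθ hε hε0 hα
    (s₀ := Real.toNNReal (√(n : ℝ) * s₀)) (x₀ := Real.toNNReal (√(n : ℝ) * x₀))
    (Real.toNNReal_pos.2 (by positivity)) (Real.toNNReal_pos.2 (by positivity))
    (fun j => Real.toNNReal (√(n : ℝ) * (z j).1)) (fun j => Real.toNNReal (√(n : ℝ) * (z j).2))
    (fun j => Real.toNNReal_le_toNNReal (mul_le_mul_of_nonneg_left (hs j) hr.le))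
    (fun j => Real.toNNReal_le_toNNReal (mul_le_mul_of_nonneg_left (hx j) hr.le))
  have hc : ∀ a : ℝ, 0 < a → ((Real.toNNReal (√(n : ℝ) * a) : ℝ≥0) : ℝ) = √(n : ℝ) * a :=
    fun a ha => Real.coe_toNNReal _ (by positivity)
  simp only [hc _ hs₀, hc _ hx₀, hc _ (hs₀.trans_le (hs _)), hc _ (hx₀.trans_le (hx _)),
    ← mul_sub, abs_mul, abs_of_pos hr] at h
  have heq : ∀ ω, (θ * ∑ j, ε j * L (Real.toNNReal (√(n : ℝ) * (z j).1))
      (Real.toNNReal (√(n : ℝ) * (z j).2)) ω : ℝ) =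
      ∑ j, ε j * (θ * L (Real.toNNReal (√(n : ℝ) * (z j).1))
      (Real.toNNReal (√(n : ℝ) * (z j).2)) ω) := by
    intro ω
    rw [Finset.mul_sum]
    exact Finset.sum_congr rfl fun j _ => by ring
  simp only [heq] at h
  refine le_trans ?_ (Finset.single_le_sum (fun _ _ => zero_le)
    (mem_oppositeMaps (t := (χ, π, ρ)).2 ⟨hπ, hρ⟩))
  have hle1 : ‖∫ ω, Complex.exp (Complex.I * ((∑ j, ε j * (θ * L (Real.toNNReal (√(n : ℝ) * (z j).1))
      (Real.toNNReal (√(n : ℝ) * (z j).2)) ω) : ℝ) : ℂ)) ∂P‖ ≤ 1 := by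
    refine (norm_integral_le_of_norm_le_const (C := 1)
      (Filter.Eventually.of_forall fun ω => ?_)).trans (by simp)
    rw [mul_comm, Complex.norm_exp_ofReal_mul_I]
  have h2 := le_prod_exp_div (norm_nonneg _) hle1 h
  rw [← ofReal_norm]
  refine (ENNReal.ofReal_le_ofReal h2).trans (le_of_eq ?_)
  rw [ENNReal.ofReal_prod_of_nonneg fun j _ => (Real.exp_pos _).le]
  refine Finset.prod_congr rfl fun j _ => ?_
  unfold expKernel
  rw [← ENNReal.ofReal_mul (Real.exp_pos _).le, ← Real.exp_add]
  congr 2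
  simp only
  rw [show √(n : ℝ) * x₀ * (√(n : ℝ) * |(z j).1 - (z (π j)).1|) +
    √(n : ℝ) * s₀ * (√(n : ℝ) * |(z j).2 - (z (ρ j)).2|) =
    n * (x₀ * |(z j).1 - (z (π j)).1| + s₀ * |(z j).2 - (z (ρ j)).2|) by
    linear_combination (x₀ * |(z j).1 - (z (π j)).1| + s₀ * |(z j).2 - (z (ρ j)).2|) * hrr]
  field_simp
  ring

/-! ### Expansion and bound of the even moments -/

/-- The even moments of `∫ g(z) exp(i φ(z, ω)) dz`, expanded as an integral of characteristic
functions. -/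
lemma ofReal_integral_norm_pow_le {E : Type*} [MeasurableSpace E] {μ : Measure E} [SigmaFinite μ]
    [IsProbabilityMeasure P] {g : E → ℝ} (hg : Measurable g) (hgi : Integrable g μ)
    {φ : E → Ω → ℝ} (hφ : Measurable (Function.uncurry φ)) (k : ℕ) :
    ENNReal.ofReal (∫ ω, ‖∫ z, (g z : ℂ) * Complex.exp (Complex.I * (φ z ω : ℂ)) ∂μ‖ ^ (2 * k) ∂P) ≤
      ∫⁻ z : Fin k × Bool → E, (∏ j, ‖g (z j)‖ₑ) *
        ‖∫ ω, Complex.exp (Complex.I *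
          ((∑ j : Fin k × Bool, ((if j.2 then 1 else -1 : ℤ) : ℝ) * φ (z j) ω : ℝ) : ℂ)) ∂P‖ₑ
        ∂(Measure.pi fun _ => μ) := by
  let e : Fin k × Bool → ℝ := fun j => ((if j.2 then 1 else -1 : ℤ) : ℝ)
  let U : Ω → ℂ := fun ω => ∫ z, (g z : ℂ) * Complex.exp (Complex.I * (φ z ω : ℂ)) ∂μ
  let F : (Fin k × Bool → E) → Ω → ℂ := fun z ω =>
    (∏ j, (g (z j) : ℂ)) * Complex.exp (Complex.I * ((∑ j, e j * φ (z j) ω : ℝ) : ℂ))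
  have hU : ∀ ω, ((‖U ω‖ ^ (2 * k) : ℝ) : ℂ) = ∫ z, F z ω ∂(Measure.pi fun _ => μ) := by
    intro ω
    have h1 : ∀ j : Fin k × Bool, (∫ z, (g z : ℂ) * Complex.exp (Complex.I * ((e j * φ z ω : ℝ) : ℂ)) ∂μ)
        -- The Boolean index separates the `k` factors `U` from the `k` conjugates.
        = if j.2 then U ω else (starRingEnd ℂ) (U ω) := by
      rintro ⟨j, b⟩
      cases b
      · simp only [e, U, ← integral_conj, Bool.false_eq_true, if_false]
        refine integral_congr_ae (Filter.Eventually.of_forall fun z => ?_)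
        simp only [map_mul, Complex.conj_ofReal, ← Complex.exp_conj, Complex.conj_I]
        congr 2
        push_cast
        ring
      · simp [e, U]
    have h2 : ∀ z : Fin k × Bool → E, F z ω =
        ∏ j, ((g (z j) : ℂ) * Complex.exp (Complex.I * ((e j * φ (z j) ω : ℝ) : ℂ))) := by
      intro z
      simp only [F]
      rw [Finset.prod_mul_distrib, ← Complex.exp_sum]
      congr 2
      push_cast
      rw [Finset.mul_sum]
    simp only [h2]
    rw [integral_fintype_prod_eq_prod
      (fun (j : Fin k × Bool) z => (g z : ℂ) * Complex.exp (Complex.I * ((e j * φ z ω : ℝ) : ℂ)))]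
    simp only [h1]
    rw [Fintype.prod_prod_type]
    simp only [Fintype.prod_bool, if_true, Bool.false_eq_true, if_false, Complex.mul_conj,
      Complex.normSq_eq_norm_sq, Finset.prod_const, Finset.card_univ, Fintype.card_fin]
    push_cast
    rw [pow_mul]
  have hφm : ∀ j : Fin k × Bool, Measurable fun p : Ω × (Fin k × Bool → E) => φ (p.2 j) p.1 := by
    intro j
    exact Measurable.comp (g := Function.uncurry φ)
      (f := fun p : Ω × (Fin k × Bool → E) => (p.2 j, p.1)) hφ (by fun_prop)
  have hFm : Measurable (fun p : Ω × (Fin k × Bool → E) => F p.2 p.1) := by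
    simp only [F]
    fun_prop
  have hFn : ∀ z ω, ‖F z ω‖ = ∏ j, ‖g (z j)‖ := by
    intro z ω
    simp only [F]
    rw [norm_mul, mul_comm Complex.I, Complex.norm_exp_ofReal_mul_I, mul_one, norm_prod]
    simp only [Complex.norm_real]
  have hFi : Integrable (Function.uncurry fun ω z => F z ω) (P.prod (Measure.pi fun _ => μ)) := by
    have hgp : Integrable (fun z : Fin k × Bool → E => ∏ j, ‖g (z j)‖) (Measure.pi fun _ => μ) :=
      Integrable.fintype_prod (f := fun _ x => ‖g x‖) fun _ => hgi.norm
    refine (hgp.comp_snd P).mono' hFm.aestronglyMeasurable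
      (Filter.Eventually.of_forall fun p => ?_)
    exact (hFn p.2 p.1).le
  have h3 : ((∫ ω, ‖U ω‖ ^ (2 * k) ∂P : ℝ) : ℂ) =
      ∫ z, ∫ ω, F z ω ∂P ∂(Measure.pi fun _ => μ) := by
    rw [← integral_complex_ofReal]
    simp only [hU]
    exact integral_integral_swap hFi
  have h4 : ENNReal.ofReal (∫ ω, ‖U ω‖ ^ (2 * k) ∂P) =
      ‖∫ z, ∫ ω, F z ω ∂P ∂(Measure.pi fun _ => μ)‖ₑ := by
    rw [← h3, ← ofReal_norm, Complex.norm_real, Real.norm_of_nonneg]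
    exact integral_nonneg fun ω => by positivity
  change ENNReal.ofReal (∫ ω, ‖U ω‖ ^ (2 * k) ∂P) ≤ _
  rw [h4]
  refine (enorm_integral_le_lintegral_enorm _).trans (lintegral_mono fun z => le_of_eq ?_)
  simp only [F]
  rw [integral_const_mul, enorm_mul]
  congr 1
  rw [← ofReal_norm, norm_prod, ENNReal.ofReal_prod_of_nonneg fun _ _ => norm_nonneg _]
  exact Finset.prod_congr rfl fun j _ => by rw [Complex.norm_real, ofReal_norm]

/-- Moment bound for the complex field `z ↦ n K √(z₁ z₂) exp(i θ L(√n z))`. -/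
lemma integral_norm_pow_le [IsProbabilityMeasure P] (hL : IsLevySheet P L Ψ)
    (hLmeas : Measurable fun p : (ℝ≥0 × ℝ≥0) × Ω => L p.1.1 p.1.2 p.2)
    {θ : ℝ} (hθ : (Ψ θ).re ≠ 0) (k : ℕ) {α : ℝ} (hα0 : 0 < α)
    (hα : ∀ v : ℤ, |v| ≤ Fintype.card (Fin k × Bool) → (Ψ (θ * v)).re ≠ 0 → α ≤ (Ψ (θ * v)).re)
    {f : ℝ × ℝ → ℝ} (hf : Measurable f) {s₀ s₀' x₀ x₀' : ℝ} (hs₀ : 0 < s₀) (hs₀' : s₀' < 2 * s₀)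
    (hx₀ : 0 < x₀) (hx₀' : x₀' < 2 * x₀) {n : ℕ} (hn : 1 ≤ n) (K : ℝ)
    (hfi : Integrable (fun z => f z ^ 2) (volume.restrict (Set.Icc s₀ s₀' ×ˢ Set.Icc x₀ x₀')))
    (hgi : Integrable (fun z => f z * (n * K * √(z.1 * z.2)))
      (volume.restrict (Set.Icc s₀ s₀' ×ˢ Set.Icc x₀ x₀'))) :
    ∫ ω, ‖∫ z in Set.Icc s₀ s₀' ×ˢ Set.Icc x₀ x₀', ((f z * (n * K * √(z.1 * z.2)) : ℝ) : ℂ) *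
      Complex.exp (Complex.I * ((θ * L (Real.toNNReal (√(n : ℝ) * z.1))
        (Real.toNNReal (√(n : ℝ) * z.2)) ω : ℝ) : ℂ))‖ ^ (2 * k) ∂P ≤
    (oppositeMaps (Fin k × Bool)).card *
      (16 * K ^ 2 * (Fintype.card (Fin k × Bool) + 1) ^ 2 / α ^ 2 *
        ∫ z in Set.Icc s₀ s₀' ×ˢ Set.Icc x₀ x₀', f z ^ 2) ^ k := by
  set S : Set (ℝ × ℝ) := Set.Icc s₀ s₀' ×ˢ Set.Icc x₀ x₀' with hS
  have hSm : MeasurableSet S := measurableSet_Icc.prod measurableSet_Icc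
  set μ : Measure (ℝ × ℝ) := volume.restrict S with hμ
  let g : ℝ × ℝ → ℝ := fun z => f z * (n * K * √(z.1 * z.2))
  have hg : Measurable g := by fun_prop
  set ι := Fin k × Bool with hι
  set M : ℝ := Fintype.card ι + 1 with hM
  have hM0 : 0 < M := by positivity
  have hn0 : (0 : ℝ) < n := by exact_mod_cast hn
  have hφ : Measurable (Function.uncurry fun (z : ℝ × ℝ) ω =>
      θ * L (Real.toNNReal (√(n : ℝ) * z.1)) (Real.toNNReal (√(n : ℝ) * z.2)) ω) := by
    have h1 : Measurable fun p : (ℝ × ℝ) × Ω => (((Real.toNNReal (√(n : ℝ) * p.1.1),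
      Real.toNNReal (√(n : ℝ) * p.1.2)), p.2) : (ℝ≥0 × ℝ≥0) × Ω) := by fun_prop
    exact (hLmeas.comp h1).const_mul θ
  have hfint : 0 ≤ ∫ z, f z ^ 2 ∂μ := integral_nonneg fun z => sq_nonneg _
  rw [← ENNReal.ofReal_le_ofReal_iff (by positivity)]
  refine (ofReal_integral_norm_pow_le hg hgi hφ k).trans ?_
  have hae : ∀ᵐ z ∂(Measure.pi fun _ : ι => μ), ∀ j, z j ∈ S := by
    refine ae_all_iff.2 fun j => ?_
    exact (Measure.quasiMeasurePreserving_eval (fun _ : ι => μ) j).ae (ae_restrict_mem hSm)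
  let c := α * n / (2 * M) * x₀
  let d := α * n / (2 * M) * s₀
  have hc : 0 < c := by positivity
  have hd : 0 < d := by positivity
  let D := ENNReal.ofReal (1 / c * (1 / d))
  let A := ∫⁻ z, ‖g z‖ₑ ^ 2 ∂μ
  let I : (ι → Bool) × (ι → ι) × (ι → ι) → (ι → ℝ × ℝ) → ENNReal := fun t z =>
    ∏ j, (‖g (z j)‖ₑ * expKernel c d (z j, z (t.2.1 j), z (t.2.2 j)))
  have hkm := measurable_expKernel c d
  have hIm : ∀ t, Measurable (I t) := by
    intro t
    simp only [I]
    fun_prop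
  have hI : ∀ t : (ι → Bool) × (ι → ι) × (ι → ι), (∀ j, t.1 (t.2.1 j) ≠ t.1 j) →
      (∀ j, t.1 (t.2.2 j) ≠ t.1 j) → ∫⁻ z, I t z ∂(Measure.pi fun _ => μ) ≤ (A * D) ^ k := by
    intro t h1 h2
    have h := lintegral_prod_mul_kernel_sq_le (μ := μ) h1 h2 (G := fun z => ‖g z‖ₑ) (by fun_prop)
      hkm (lintegral_expKernel_sq_le hc hd S)
    rw [Fintype.card_prod, Fintype.card_fin, Fintype.card_bool, pow_mul] at h
    exact (ENNReal.pow_le_pow_left_iff two_ne_zero).1 h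
  -- On the rectangle `z.1 * z.2 ≤ 4 s₀ x₀`, because the endpoints are less than doubled.
  have hAle : A ≤ ENNReal.ofReal (4 * s₀ * x₀ * n ^ 2 * K ^ 2 * ∫ z, f z ^ 2 ∂μ) := by
    rw [← integral_const_mul, ofReal_integral_eq_lintegral_ofReal (hfi.const_mul _)
      (Filter.Eventually.of_forall fun z => by positivity)]
    refine lintegral_mono_ae ?_
    filter_upwards [ae_restrict_mem hSm] with z hz
    rw [← ofReal_norm, ← ENNReal.ofReal_pow (norm_nonneg _)]
    refine ENNReal.ofReal_le_ofReal ?_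
    rw [Real.norm_eq_abs, sq_abs]
    simp only [g]
    obtain ⟨⟨h1, h2⟩, h3, h4⟩ := hz
    have hz1 : 0 ≤ z.1 := hs₀.le.trans h1
    have hz2 : 0 ≤ z.2 := hx₀.le.trans h3
    have hzz : z.1 * z.2 ≤ 2 * s₀ * (2 * x₀) :=
      mul_le_mul (h2.trans hs₀'.le) (h4.trans hx₀'.le) hz2 (by positivity)
    rw [mul_pow, mul_pow, Real.sq_sqrt (mul_nonneg hz1 hz2)]
    have h5 : 0 ≤ f z ^ 2 * (n * K) ^ 2 := by positivity
    have := mul_le_mul_of_nonneg_left hzz h5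
    linarith
  -- `D = 4 M² / (α² n² s₀ x₀)` cancels both `n²` and `s₀ x₀`, leaving `4 * 4 = 16`.
  have hAD : A * D ≤ ENNReal.ofReal (16 * K ^ 2 * M ^ 2 / α ^ 2 * ∫ z, f z ^ 2 ∂μ) := by
    refine (mul_le_mul_left hAle D).trans (le_of_eq ?_)
    simp only [D]
    rw [← ENNReal.ofReal_mul (by positivity)]
    congr 1
    simp only [c, d]
    field_simp
    ring
  have hsumε : ∑ j : ι, (if j.2 then 1 else -1 : ℤ) = 0 := by
    rw [Fintype.sum_prod_type]
    simp
  calc _ ≤ ∫⁻ z, ∑ t ∈ oppositeMaps ι, I t z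
        ∂(Measure.pi fun _ => μ) := by
        refine lintegral_mono_ae ?_
        filter_upwards [hae] with z hz
        refine (mul_le_mul_right (enorm_integral_exp_le_sum hL hθ
          (ε := fun j : ι => if j.2 then 1 else -1) (fun j => by cases j.2 <;> simp) hsumε hα
          hs₀ hx₀ hn z (fun j => (hz j).1.1) (fun j => (hz j).2.1)) _).trans (le_of_eq ?_)
        rw [Finset.mul_sum]
        refine Finset.sum_congr rfl fun t _ => ?_
        simp only [I]
        rw [Finset.prod_mul_distrib]
    _ = ∑ t ∈ oppositeMaps ι, ∫⁻ z, I t z ∂(Measure.pi fun _ => μ) := lintegral_finsetSum _ fun t _ => hIm t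
    _ ≤ ∑ t ∈ oppositeMaps ι, (A * D) ^ k :=
        Finset.sum_le_sum fun t ht => hI t (mem_oppositeMaps.1 ht).1 (mem_oppositeMaps.1 ht).2
    _ = (oppositeMaps ι).card * (A * D) ^ k := by
        rw [Finset.sum_const, nsmul_eq_mul]
    _ ≤ _ := by
        rw [ENNReal.ofReal_mul (by positivity), ENNReal.ofReal_natCast,
          ENNReal.ofReal_pow (by positivity)]
        gcongr

end LevySheet

/-! ### From the complex field to its real and imaginary parts -/

theorem proposition5p4 {Ω : Type*} [MeasurableSpace Ω] (P : Measure Ω) [IsProbabilityMeasure P]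
    (L : ℝ≥0 → ℝ≥0 → Ω → ℝ) (Ψ : ℝ → ℂ) (hL : LevySheet.IsLevySheet P L Ψ)
    (hLmeas : Measurable fun p : (ℝ≥0 × ℝ≥0) × Ω => L p.1.1 p.1.2 p.2)
    (θ : ℝ) (hθ0 : 0 < θ) (hθ1 : θ < 2 * Real.pi)
    (ha : (Ψ θ).re * (Ψ (2 * θ)).re ≠ 0)
    (m : ℕ) (hm : Even m) :
    ∃ C : ℝ, 0 < C ∧
      ∀ f : ℝ × ℝ → ℝ,
        MemLp f 2 (volume.restrict (Set.Icc (0 : ℝ) 1 ×ˢ Set.Icc (0 : ℝ) 1)) →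
      ∀ s₀ s₀' x₀ x₀' : ℝ, 0 < s₀ → s₀ < s₀' → s₀' < 2 * s₀ → s₀' ≤ 1 →
        0 < x₀ → x₀ < x₀' → x₀' < 2 * x₀ → x₀' ≤ 1 →
      ∀ i : Fin 2, ∀ n : ℕ, 1 ≤ n →
        Integrable (fun ω => (∫ z in Set.Icc s₀ s₀' ×ˢ Set.Icc x₀ x₀',
          f z * LevySheet.thetaField i L Ψ θ n z.1 z.2 ω) ^ m) P ∧
        ∫ ω, (∫ z in Set.Icc s₀ s₀' ×ˢ Set.Icc x₀ x₀',
          f z * LevySheet.thetaField i L Ψ θ n z.1 z.2 ω) ^ m ∂P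
        ≤ C * (∫ z in Set.Icc s₀ s₀' ×ˢ Set.Icc x₀ x₀', f z ^ 2) ^ (m / 2) := by
  classical
  obtain ⟨k, rfl⟩ := even_iff_two_dvd.1 hm
  have hθ : (Ψ θ).re ≠ 0 := left_ne_zero_of_mul ha
  obtain ⟨α, hα0, hα⟩ := LevySheet.exists_pos_le_re_exponent hL θ (Fintype.card (Fin k × Bool))
  let K := LevySheet.constK Ψ θ
  let N : ℝ := (LevySheet.oppositeMaps (Fin k × Bool)).card
  let B : ℝ := 16 * K ^ 2 * (Fintype.card (Fin k × Bool) + 1) ^ 2 / α ^ 2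
  have hB : 0 ≤ B := by positivity
  -- The added `1` only ensures that the constant is positive.
  refine ⟨N * B ^ k + 1, by positivity, ?_⟩
  intro f₀ hf₀ s₀ s₀' x₀ x₀' hs₀ hss hs₀' hs1 hx₀ hxx hx₀' hx1 i n hn
  rw [Nat.mul_div_cancel_left k two_pos]
  set S : Set (ℝ × ℝ) := Set.Icc s₀ s₀' ×ˢ Set.Icc x₀ x₀' with hS
  have hSm : MeasurableSet S := measurableSet_Icc.prod measurableSet_Icc
  have hSsub : S ⊆ Set.Icc (0 : ℝ) 1 ×ˢ Set.Icc (0 : ℝ) 1 :=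
    Set.prod_mono (Set.Icc_subset_Icc hs₀.le hs1) (Set.Icc_subset_Icc hx₀.le hx1)
  have hSfin : IsFiniteMeasure (volume.restrict S) := by
    refine ⟨?_⟩
    rw [Measure.restrict_apply_univ]
    exact (isCompact_Icc.prod isCompact_Icc).measure_lt_top
  have hfS : MemLp f₀ 2 (volume.restrict S) :=
    hf₀.mono_measure (Measure.restrict_mono hSsub le_rfl)
  -- A measurable representative changes none of the integrals and makes the Fubini argument
  -- applicable.
  obtain ⟨f, hfm, hff⟩ : ∃ f : ℝ × ℝ → ℝ, Measurable f ∧ f₀ =ᵐ[volume.restrict S] f :=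
    ⟨_, hfS.1.stronglyMeasurable_mk.measurable, hfS.1.ae_eq_mk⟩
  have hf2 : MemLp f 2 (volume.restrict S) := hfS.ae_eq hff
  have e1 : ∀ ω, ∫ z in S, f₀ z * LevySheet.thetaField i L Ψ θ n z.1 z.2 ω =
      ∫ z in S, f z * LevySheet.thetaField i L Ψ θ n z.1 z.2 ω := fun ω =>
    integral_congr_ae (hff.mul (Filter.EventuallyEq.refl _ _))
  have e2 : ∫ z in S, f₀ z ^ 2 = ∫ z in S, f z ^ 2 := by
    refine integral_congr_ae ?_
    filter_upwards [hff] with z hz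
    rw [hz]
  simp only [e1, e2]
  have hf1 : Integrable f (volume.restrict S) := hf2.integrable (by norm_num)
  have hgi : Integrable (fun z => f z * (n * K * √(z.1 * z.2))) (volume.restrict S) := by
    refine hf1.mul_bdd (c := |(n : ℝ) * K|) (by fun_prop) ?_
    filter_upwards [ae_restrict_mem hSm] with z hz
    have hz' := hSsub hz
    rw [norm_mul, Real.norm_eq_abs, Real.norm_eq_abs, abs_of_nonneg (Real.sqrt_nonneg _)]
    refine mul_le_of_le_one_right (abs_nonneg _) ?_
    rw [Real.sqrt_le_one]
    exact mul_le_one₀ hz'.1.2 hz'.2.1 hz'.2.2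
  let φ : ℝ × ℝ → Ω → ℝ := fun z ω =>
    θ * L (Real.toNNReal (√(n : ℝ) * z.1)) (Real.toNNReal (√(n : ℝ) * z.2)) ω
  have hφ : Measurable (Function.uncurry φ) := by
    have h1 : Measurable fun p : (ℝ × ℝ) × Ω => (((Real.toNNReal (√(n : ℝ) * p.1.1),
      Real.toNNReal (√(n : ℝ) * p.1.2)), p.2) : (ℝ≥0 × ℝ≥0) × Ω) := by fun_prop
    exact (hLmeas.comp h1).const_mul θ
  let h : ℝ × ℝ → Ω → ℂ := fun z ω => ((f z * (n * K * √(z.1 * z.2)) : ℝ) : ℂ) *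
      Complex.exp (Complex.I * (φ z ω : ℂ))
  have hhm : Measurable fun p : Ω × (ℝ × ℝ) => h p.2 p.1 := by
    have : Measurable fun p : Ω × (ℝ × ℝ) => φ p.2 p.1 := hφ.comp measurable_swap
    simp only [h]
    fun_prop
  let U : Ω → ℂ := fun ω => ∫ z in S, h z ω
  have hUm : Measurable U :=
    (hhm.stronglyMeasurable.integral_prod_right' (ν := volume.restrict S)).measurable
  have hhn : ∀ z ω, ‖h z ω‖ = ‖f z * (n * K * √(z.1 * z.2))‖ := by
    intro z ω
    simp only [h]
    rw [norm_mul, mul_comm Complex.I, Complex.norm_exp_ofReal_mul_I, mul_one, Complex.norm_real]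
  have hhi : ∀ ω, Integrable (fun z => h z ω) (volume.restrict S) := fun ω =>
    hgi.norm.mono' (hhm.comp (measurable_prodMk_left (x := ω))).aestronglyMeasurable
      (Filter.Eventually.of_forall fun z => (hhn z ω).le)
  have hUn : ∀ ω, ‖U ω‖ ≤ ∫ z in S, ‖f z * (n * K * √(z.1 * z.2))‖ := fun ω =>
    (norm_integral_le_integral_norm _).trans (le_of_eq (by simp only [hhn]))
  have hUi : Integrable (fun ω => ‖U ω‖ ^ (2 * k)) P := by
    refine Integrable.of_bound (by fun_prop) ((∫ z in S, ‖f z * (n * K * √(z.1 * z.2))‖) ^ (2 * k))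
      (Filter.Eventually.of_forall fun ω => ?_)
    rw [norm_pow, norm_norm]
    exact pow_le_pow_left₀ (norm_nonneg _) (hUn ω) _
  -- `T` is the real or the imaginary part, so both indices are treated at once.
  have hX : ∃ T : ℂ → ℝ, Measurable T ∧ (∀ w, |T w| ≤ ‖w‖) ∧
      ∀ ω, ∫ z in S, f z * LevySheet.thetaField i L Ψ θ n z.1 z.2 ω = T (U ω) := by
    have hexp : ∀ x : ℝ, Complex.exp (Complex.I * (x : ℂ)) = (Real.cos x : ℂ) + Real.sin x * Complex.I := by
      intro x
      rw [mul_comm, Complex.exp_mul_I, Complex.ofReal_cos, Complex.ofReal_sin]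
    fin_cases i
    · refine ⟨Complex.re, Complex.measurable_re, Complex.abs_re_le_norm, fun ω => ?_⟩
      have : (U ω).re = ∫ z in S, (h z ω).re := (integral_re (hhi ω)).symm
      rw [this]
      refine integral_congr_ae (Filter.Eventually.of_forall fun z => ?_)
      simp only [h, hexp, Complex.re_ofReal_mul]
      simp [LevySheet.thetaField, LevySheet.theta1, φ, K, -Complex.ofReal_cos, -Complex.ofReal_sin]
      ring
    · refine ⟨Complex.im, Complex.measurable_im, Complex.abs_im_le_norm, fun ω => ?_⟩
      have : (U ω).im = ∫ z in S, (h z ω).im := (integral_im (hhi ω)).symm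
      rw [this]
      refine integral_congr_ae (Filter.Eventually.of_forall fun z => ?_)
      simp only [h, hexp, Complex.im_ofReal_mul]
      simp [LevySheet.thetaField, LevySheet.theta2, φ, K, -Complex.ofReal_cos, -Complex.ofReal_sin]
      ring
  obtain ⟨T, hTm, hTn, hT⟩ := hX
  simp only [hT]
  have hTle : ∀ ω, ‖T (U ω) ^ (2 * k)‖ ≤ ‖U ω‖ ^ (2 * k) := fun ω => by
    rw [norm_pow]
    exact pow_le_pow_left₀ (norm_nonneg _) (hTn _) _
  have hTi : Integrable (fun ω => T (U ω) ^ (2 * k)) P :=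
    hUi.mono' ((hTm.comp hUm).pow_const _).aestronglyMeasurable (Filter.Eventually.of_forall hTle)
  refine ⟨hTi, ?_⟩
  have hmain := LevySheet.integral_norm_pow_le hL hLmeas hθ k hα0 (by exact_mod_cast hα) hfm hs₀
    hs₀' hx₀ hx₀' hn K hf2.integrable_sq hgi
  have hf0 : 0 ≤ ∫ z in S, f z ^ 2 := integral_nonneg fun z => sq_nonneg _
  calc ∫ ω, T (U ω) ^ (2 * k) ∂P ≤ ∫ ω, ‖U ω‖ ^ (2 * k) ∂P :=
        integral_mono hTi hUi fun ω => (le_abs_self _).trans (hTle ω)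
    _ ≤ N * (B * ∫ z in S, f z ^ 2) ^ k := hmain
    _ = N * B ^ k * (∫ z in S, f z ^ 2) ^ k := by rw [mul_pow]; ring
    _ ≤ (N * B ^ k + 1) * (∫ z in S, f z ^ 2) ^ k := by
        refine mul_le_mul_of_nonneg_right (by linarith) (by positivity)
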